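/- **Setting.** Let $k$ be an algebraically closed field of characteristic $0$. Let $A=(a_{ij})$ be an $n\times n$ generalized Cartan matrix (integer entries, $a_{ii}=2$, $a_{ij}\le 0$ for $i\ne j$, and $a_{ij}=0\Rightarrow a_{ji}=0$), and let $(\mathfrak h,\Pi,\Pi^\vee)$ be a realization of it: $\mathfrak h$ is a $k$-vector space of dimension $2n-\operatorname{rank}A$, $\Pi=\{\alpha_1,\dots,\alpha_n\}\subset\mathfrak h^*$ and $\Pi^\vee=\{\alpha_1^\vee,\dots,\alpha_n^\vee\}\subset\mathfrak h$ are linearly independent, and $\langle\alpha_i^\vee,\alpha_j\rangle=a_{ij}$. Let $\mathfrak g$ be the associated Kac--Moody algebra: the Lie algebra generated by $\mathfrak h$ and $e_i,f_i$ $(1\le i\le n)$ with relations $[h,h']=0$, $[h,e_i]=\alpha_i(h)e_i$, $[h,f_i]=-\alpha_i(h)f_i$, $[e_i,f_j]=\delta_{ij}\alpha_i^\vee$, modulo its largest ideal meeting $\mathfrak h$ trivially. Let $\Delta=\Delta^+\sqcup\Delta^-$ be its set of roots and $\mathfrak g_\alpha$ its root spaces. Let $\tau$ be the anti-involution of $U\mathfrak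 g$ with $\tau(e_i)=f_i$, $\tau(f_i)=e_i$, $\tau|_{\mathfrak h}=\mathrm{id}$. Fix a subset $\Xi\subset\Pi$, and put $\Delta_\Xi=\Delta\cap\mathbb Z\Xi$, $\Delta_\Xi^\pm=\Delta_\Xi\cap\Delta^\pm$, $$\mathfrak l_\Xi=\mathfrak h\oplus\bigoplus_{\alpha\in\Delta_\Xi}\mathfrak g_\alpha,\qquad \mathfrak u^\pm_\Xi=\bigoplus_{\alpha\in\Delta^\pm\setminus\Delta^\pm_\Xi}\mathfrak g_\alpha,\qquad \mathfrak p^\pm_\Xi=\bigoplus_{\alpha\in\Delta^\mp_\Xi}\mathfrak g_\alpha\oplus\mathfrak h\oplus\bigoplus_{\alpha\in\Delta^\pm}\mathfrak g_\alpha=\mathfrak l_\Xi\oplus\mathfrak u_\Xi^\pm .$$ **Restriction.** Define functors from $\mathfrak g$-modules to $\mathfrak l_\Xi$-modules, with the $\mathfrak l_\Xi$-action inherited from $M$, by $$\operatorname{Res}^!_\Xi(M)=\{m\in M:\mathfrak u^+_\Xi m=0\},\qquad \operatorname{Res}^*_\Xi(M)=M/\mathfrak u^-_\Xi M,$$ and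 let $\operatorname{Res}^{!*}_\Xi$ be the image of the natural transformation $\operatorname{Res}^!_\Xi\hookrightarrow(\text{forgetful functor})\twoheadrightarrow\operatorname{Res}^*_\Xi$. **Induction.** For an $\mathfrak l_\Xi$-module $N$, inflated to $\mathfrak p^\pm_\Xi$ through $\mathfrak p^\pm_\Xi\twoheadrightarrow\mathfrak l_\Xi$, let $$\operatorname{Ind}_{\Xi,!}(N)=U\mathfrak g\otimes_{U\mathfrak p^+_\Xi}N,\qquad \operatorname{Ind}_{\Xi,*}(N)=\operatorname{Hom}_{U\mathfrak p^-_\Xi}(U\mathfrak g,N).$$ In the second formula $Y\in U\mathfrak p_\Xi^-$ acts on $U\mathfrak g$ by $X\mapsto X\tau(Y)$, so that the elements are the additive maps $\varphi:U\mathfrak g\to N$ with $\varphi(X\tau(Y))=Y\varphi(X)$, and $Z\in U\mathfrak g$ acts on them by $(Z\varphi)(X)=\varphi(\tau(Z)X)$. There are canonical natural transformations $$\mathrm{ev}^!:\operatorname{Res}^!_\Xi\circ\operatorname{Ind}_{\Xi,*}\to\operatorname{id},\ \varphi\mapsto\varphi(1);\qquad \mathrm{ev}^*:\operatorname{Res}^*_\Xi\circ\operatorname{Ind}_{\Xi,*}\to\operatorname{id},\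 [\varphi]\mapsto\varphi(1);\qquad \mathrm{coev}:\operatorname{id}\to\operatorname{Res}^*_\Xi\circ\operatorname{Ind}_{\Xi,!},\ x\mapsto[1\otimes x];$$ the counit $\operatorname{Ind}_{\Xi,!}\operatorname{Res}^!_\Xi M\to M$, $X\otimes m\mapsto Xm$; and the unit $M\to\operatorname{Ind}_{\Xi,*}\operatorname{Res}^*_\Xi M$, $m\mapsto(X\mapsto[\tau(X)m])$. **Claim.** 1. $\mathrm{ev}^!$ and $\mathrm{coev}$ are isomorphisms. Let $c:\operatorname{Ind}_{\Xi,!}\to\operatorname{Ind}_{\Xi,*}$ be the composite $$\operatorname{Ind}_{\Xi,!}\xrightarrow{\operatorname{Ind}_{\Xi,!}((\mathrm{ev}^!)^{-1})}\operatorname{Ind}_{\Xi,!}\operatorname{Res}^!_\Xi\operatorname{Ind}_{\Xi,*}\xrightarrow{\text{counit}}\operatorname{Ind}_{\Xi,*}.$$ Then $c$ is also the composite $\operatorname{Ind}_{\Xi,!}\xrightarrow{\text{unit}}\operatorname{Ind}_{\Xi,*}\operatorname{Res}^*_\Xi\operatorname{Ind}_{\Xi,!}\xrightarrow{\operatorname{Ind}_{\Xi,*}(\mathrm{coev}^{-1})}\operatorname{Ind}_{\Xi,*}$.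 2. Let $\operatorname{Ind}_{\Xi,!*}$ be the image of $c$, with inclusion $\iota:\operatorname{Ind}_{\Xi,!*}\hookrightarrow\operatorname{Ind}_{\Xi,*}$. Then $$\operatorname{Res}^!_\Xi\circ\operatorname{Ind}_{\Xi,!*}\;\cong\;\operatorname{Res}^*_\Xi\circ\operatorname{Ind}_{\Xi,!*}\;\cong\;\operatorname{Res}^{!*}_\Xi\circ\operatorname{Ind}_{\Xi,!*}\;\cong\;\operatorname{id}$$ as functors on the category of all $\mathfrak l_\Xi$-modules. More precisely, the following canonical natural transformations are isomorphisms: $\mathrm{ev}^!\circ\operatorname{Res}^!_\Xi(\iota):\operatorname{Res}^!_\Xi\operatorname{Ind}_{\Xi,!*}\to\operatorname{id}$; $\mathrm{ev}^*\circ\operatorname{Res}^*_\Xi(\iota):\operatorname{Res}^*_\Xi\operatorname{Ind}_{\Xi,!*}\to\operatorname{id}$; and the composite of the inclusion $\operatorname{Res}^{!*}_\Xi\operatorname{Ind}_{\Xi,!*}\hookrightarrow\operatorname{Res}^{*}_\Xi\operatorname{Ind}_{\Xi,!*}$ with the latter. -/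

import Mathlib

open CategoryTheory
open scoped TensorProduct

universe u

noncomputable section

namespace KacMoody

/-- A generalized Cartan matrix `A` of size `n` together with a realization `(𝔥, Π, Π^∨)` of it:
`root i` are the simple roots, `coroot i` the simple coroots, both families are linearly
independent, `⟨α_i^∨, α_j⟩ = a_ij`, and `dim 𝔥 = 2 n - rank A`. -/
structure Datum (k : Type u) [Field k] (h : Type u) [AddCommGroup h] [Module k h] (n : ℕ) where
  A : Matrix (Fin n) (Fin n) ℤ
  diag : ∀ i, A i i = 2
  off_diag : ∀ i j, i ≠ j → A i j ≤ 0
  zero_symm : ∀ i j, A i j = 0 → A j i = 0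
  root : Fin n → Module.Dual k h
  coroot : Fin n → h
  linInd_root : LinearIndependent k root
  linInd_coroot : LinearIndependent k coroot
  root_coroot : ∀ i j, root j (coroot i) = (A i j : k)
  finite : Module.Finite k h
  dim : Module.finrank k h + (A.map (Int.cast : ℤ → k)).rank = 2 * n

/-- Generators of the Lie algebra: the elements of `𝔥` and the Chevalley generators. -/
inductive Gen (h : Type u) (n : ℕ) : Type u
  | H : h → Gen h n
  | e : Fin n → Gen h n
  | f : Fin n → Gen h n

variable {k : Type u} [Field k] {h : Type u} [AddCommGroup h] [Module k h] {n : ℕ}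

section Algebra

attribute [local instance 100] LieRing.ofAssociativeRing

variable (D : Datum k h n)

/-- The free generators. -/
abbrev gen (_ : Datum k h n) (x : Gen h n) : FreeLieAlgebra k (Gen h n) := FreeLieAlgebra.of k x

/-- The defining relators of the auxiliary algebra `𝔤̃(A)`. The first two make `𝔥 → 𝔤̃(A)`
linear. -/
inductive Relator : FreeLieAlgebra k (Gen h n) → Prop
  | add (x y : h) : Relator (gen D (.H (x + y)) - (gen D (.H x) + gen D (.H y)))
  | smul (c : k) (x : h) : Relator (gen D (.H (c • x)) - c • gen D (.H x))
  | HH (x y : h) : Relator ⁅gen D (.H x), gen D (.H y)⁆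
  | HE (x : h) (i : Fin n) : Relator (⁅gen D (.H x), gen D (.e i)⁆ - D.root i x • gen D (.e i))
  | HF (x : h) (i : Fin n) : Relator (⁅gen D (.H x), gen D (.f i)⁆ + D.root i x • gen D (.f i))
  | EF_same (i : Fin n) : Relator (⁅gen D (.e i), gen D (.f i)⁆ - gen D (.H (D.coroot i)))
  | EF_ne (i j : Fin n) (hij : i ≠ j) : Relator ⁅gen D (.e i), gen D (.f j)⁆

/-- The ideal generated by the relators. -/
def relIdeal : LieIdeal k (FreeLieAlgebra k (Gen h n)) :=
  LieSubmodule.lieSpan k (FreeLieAlgebra k (Gen h n)) {x | Relator D x}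

/-- The auxiliary Lie algebra `𝔤̃(A)`. -/
def Aux : Type u := FreeLieAlgebra k (Gen h n) ⧸ relIdeal D

instance : LieRing (Aux D) :=
  inferInstanceAs (LieRing (FreeLieAlgebra k (Gen h n) ⧸ relIdeal D))

instance : LieAlgebra k (Aux D) :=
  inferInstanceAs (LieAlgebra k (FreeLieAlgebra k (Gen h n) ⧸ relIdeal D))

/-- The quotient map from the free Lie algebra to `𝔤̃(A)`. -/
def auxQuot : FreeLieAlgebra k (Gen h n) →ₗ⁅k⁆ Aux D where
  toFun x := LieSubmodule.Quotient.mk x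
  map_add' _ _ := rfl
  map_smul' _ _ := rfl
  map_lie' := rfl

theorem auxQuot_eq_zero {x : FreeLieAlgebra k (Gen h n)} : auxQuot D x = 0 ↔ x ∈ relIdeal D :=
  LieSubmodule.Quotient.mk_eq_zero'

theorem auxQuot_surjective : Function.Surjective (auxQuot D) :=
  LieSubmodule.Quotient.surjective_mk' (relIdeal D)

/-- The canonical map from the generators to `𝔤̃(A)`. -/
def auxOf (x : Gen h n) : Aux D := auxQuot D (gen D x)

/-- The maximal ideal of `𝔤̃(A)` intersecting (the image of) `𝔥` trivially: the sum of all the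
ideals with this property. -/
def radical : LieIdeal k (Aux D) :=
  sSup {I | ∀ x : h, auxOf D (.H x) ∈ I → auxOf D (.H x) = 0}

/-- The Kac--Moody algebra `𝔤(A)`. -/
def Alg : Type u := Aux D ⧸ radical D

instance : LieRing (Alg D) := inferInstanceAs (LieRing (Aux D ⧸ radical D))

instance : LieAlgebra k (Alg D) := inferInstanceAs (LieAlgebra k (Aux D ⧸ radical D))

/-- The quotient map `𝔤̃(A) → 𝔤(A)`. -/
def quot : Aux D →ₗ⁅k⁆ Alg D where
  toFun x := LieSubmodule.Quotient.mk x
  map_add' _ _ := rfl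
  map_smul' _ _ := rfl
  map_lie' := rfl

theorem quot_eq_zero {x : Aux D} : quot D x = 0 ↔ x ∈ radical D :=
  LieSubmodule.Quotient.mk_eq_zero'

theorem quot_surjective : Function.Surjective (quot D) :=
  LieSubmodule.Quotient.surjective_mk' (radical D)

theorem auxQuot_relator {x : FreeLieAlgebra k (Gen h n)} (hx : Relator D x) :
    auxQuot D x = 0 :=
  (auxQuot_eq_zero D).2 (LieSubmodule.subset_lieSpan hx)

/-- The map `𝔥 → 𝔤̃(A)`. -/
def auxH : h →ₗ[k] Aux D where
  toFun x := auxOf D (.H x)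
  map_add' x y := sub_eq_zero.1 (auxQuot_relator D (.add x y))
  map_smul' c x := sub_eq_zero.1 (auxQuot_relator D (.smul c x))

/-- The map `𝔥 → 𝔤(A)`, whose image is the Cartan subalgebra. -/
def H : h →ₗ[k] Alg D := (quot D : Aux D →ₗ[k] Alg D) ∘ₗ auxH D

/-- The Chevalley generators `e i`. -/
def e (i : Fin n) : Alg D := quot D (auxOf D (.e i))

/-- The Chevalley generators `f i`. -/
def f (i : Fin n) : Alg D := quot D (auxOf D (.f i))

theorem aux_HH (x y : h) : ⁅auxOf D (.H x), auxOf D (.H y)⁆ = 0 :=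
  auxQuot_relator D (.HH x y)

theorem aux_HE (x : h) (i : Fin n) :
    ⁅auxOf D (.H x), auxOf D (.e i)⁆ = D.root i x • auxOf D (.e i) :=
  sub_eq_zero.1 (auxQuot_relator D (.HE x i))

theorem aux_HF (x : h) (i : Fin n) :
    ⁅auxOf D (.H x), auxOf D (.f i)⁆ = -(D.root i x • auxOf D (.f i)) :=
  eq_neg_of_add_eq_zero_left (auxQuot_relator D (.HF x i))

theorem aux_EF_same (i : Fin n) :
    ⁅auxOf D (.e i), auxOf D (.f i)⁆ = auxOf D (.H (D.coroot i)) :=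
  sub_eq_zero.1 (auxQuot_relator D (.EF_same i))

theorem aux_EF_ne (i j : Fin n) (hij : i ≠ j) : ⁅auxOf D (.e i), auxOf D (.f j)⁆ = 0 :=
  auxQuot_relator D (.EF_ne i j hij)

theorem lie_HH (x y : h) : ⁅H D x, H D y⁆ = 0 := congrArg (quot D) (aux_HH D x y)

theorem lie_HE (x : h) (i : Fin n) : ⁅H D x, e D i⁆ = D.root i x • e D i :=
  congrArg (quot D) (aux_HE D x i)

theorem lie_HF (x : h) (i : Fin n) : ⁅H D x, f D i⁆ = -(D.root i x • f D i) :=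
  congrArg (quot D) (aux_HF D x i)

theorem lie_EF_same (i : Fin n) : ⁅e D i, f D i⁆ = H D (D.coroot i) :=
  congrArg (quot D) (aux_EF_same D i)

theorem lie_EF_ne (i j : Fin n) (hij : i ≠ j) : ⁅e D i, f D j⁆ = 0 :=
  congrArg (quot D) (aux_EF_ne D i j hij)


theorem free_eq_top (K : LieSubalgebra k (FreeLieAlgebra k (Gen h n)))
    (hK : ∀ x, FreeLieAlgebra.of k x ∈ K) : K = ⊤ := by
  let F : FreeLieAlgebra k (Gen h n) →ₗ⁅k⁆ K := FreeLieAlgebra.lift k fun x => ⟨_, hK x⟩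
  have hF : K.incl.comp F = LieHom.id := by
    apply FreeLieAlgebra.hom_ext
    intro x
    simp [F]
  rw [eq_top_iff]
  intro x _
  have := LieHom.congr_fun hF x
  simp only [LieHom.comp_apply, LieHom.id_apply] at this
  rw [← this]
  exact (F x).2

theorem eq_top_of_generators (K : LieSubalgebra k (Alg D)) (hH : ∀ x, H D x ∈ K)
    (he : ∀ i, e D i ∈ K) (hf : ∀ i, f D i ∈ K) : K = ⊤ := by
  have h1 : K.comap ((quot D).comp (auxQuot D)) = ⊤ := by
    apply free_eq_top
    intro x
    cases x with
    | H x => exact hH x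
    | e i => exact he i
    | f i => exact hf i
  rw [eq_top_iff]
  intro x _
  obtain ⟨y, rfl⟩ := quot_surjective D x
  obtain ⟨z, rfl⟩ := auxQuot_surjective D y
  have : z ∈ K.comap ((quot D).comp (auxQuot D)) := h1 ▸ LieSubalgebra.mem_top z
  exact this

/-- The root space `𝔤_α` (which is `𝔥` if `α = 0`, and `0` if `α` is neither `0` nor a root). -/
def rootSpace (α : Module.Dual k h) : Submodule k (Alg D) where
  carrier := {x | ∀ t : h, ⁅H D t, x⁆ = α t • x}
  add_mem' {x y} hx hy t := by rw [lie_add, hx t, hy t, smul_add]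
  zero_mem' t := by rw [lie_zero, smul_zero]
  smul_mem' c x hx t := by rw [lie_smul, hx t, smul_comm]

/-- The set `Δ` of roots. -/
def roots : Set (Module.Dual k h) := {α | α ≠ 0 ∧ rootSpace D α ≠ ⊥}

/-- The root lattice of `Ξ`, that is `ℤΞ`. -/
def rootLattice (Ξ : Set (Fin n)) : Set (Module.Dual k h) :=
  {α | ∃ z : Fin n → ℤ, (∀ i ∉ Ξ, z i = 0) ∧ α = ∑ i, z i • D.root i}

/-- `Δ⁺` (for `s = 1`) and `Δ⁻` (for `s = -1`). -/
def signedRoots (s : ℤˣ) : Set (Module.Dual k h) :=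
  {α | α ∈ roots D ∧ ∃ a : Fin n → ℕ, α = (s : ℤ) • ∑ i, a i • D.root i}

/-- The sum of the root spaces for the weights in `S`. -/
def sumSpaces (S : Set (Module.Dual k h)) : Submodule k (Alg D) := ⨆ α ∈ S, rootSpace D α

variable (Ξ : Set (Fin n)) (s : ℤˣ)

/-- The set `Δ_Ξ = Δ ∩ ℤΞ`. -/
def leviRoots : Set (Module.Dual k h) := roots D ∩ rootLattice D Ξ

/-- The space `⨁_{α ∈ Δ^{-s}_Ξ} 𝔤_α ⊕ 𝔥 ⊕ 𝔫^s` underlying the parabolic subalgebra `𝔭^s_Ξ`. -/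
def parabolicSpace : Submodule k (Alg D) :=
  sumSpaces D (leviRoots D Ξ ∩ signedRoots D (-s)) ⊔ LinearMap.range (H D) ⊔
    sumSpaces D (signedRoots D s)

/-- The space `𝔥 ⊕ ⨁_{α ∈ Δ_Ξ} 𝔤_α` underlying the Levi subalgebra `𝔩_Ξ`. -/
def leviSpace : Submodule k (Alg D) :=
  LinearMap.range (H D) ⊔ sumSpaces D (leviRoots D Ξ)

/-- The space `⨁_{α ∈ Δ^s ∖ Δ^s_Ξ} 𝔤_α` underlying the nilradical `𝔲^s_Ξ`. -/
def nilSpace : Submodule k (Alg D) :=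
  sumSpaces D (signedRoots D s \ (leviRoots D Ξ ∩ signedRoots D s))


theorem lie_mem_rootSpace {α β : Module.Dual k h} {x y : Alg D} (hx : x ∈ rootSpace D α)
    (hy : y ∈ rootSpace D β) : ⁅x, y⁆ ∈ rootSpace D (α + β) := by
  intro t
  have hx' : ⁅H D t, x⁆ = α t • x := hx t
  have hy' : ⁅H D t, y⁆ = β t • y := hy t
  rw [leibniz_lie, hx', hy', smul_lie, lie_smul, LinearMap.add_apply, add_smul]

theorem H_mem_rootSpace (t : h) : H D t ∈ rootSpace D 0 := fun t' => by
  simp [lie_HH]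

theorem e_mem_rootSpace (i : Fin n) : e D i ∈ rootSpace D (D.root i) := fun t => lie_HE D t i

theorem f_mem_rootSpace (i : Fin n) : f D i ∈ rootSpace D (-D.root i) := fun t => by
  rw [lie_HF, LinearMap.neg_apply, neg_smul]

theorem rootSpace_le_sumSpaces {S : Set (Module.Dual k h)} {α : Module.Dual k h} (hα : α ∈ S) :
    rootSpace D α ≤ sumSpaces D S :=
  le_iSup₂_of_le α hα le_rfl

theorem sumSpaces_mono {S T : Set (Module.Dual k h)} (hST : S ⊆ T) :
    sumSpaces D S ≤ sumSpaces D T :=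
  iSup₂_le fun _ hα => rootSpace_le_sumSpaces D (hST hα)

theorem sumSpaces_union (S T : Set (Module.Dual k h)) :
    sumSpaces D (S ∪ T) = sumSpaces D S ⊔ sumSpaces D T :=
  iSup_union

theorem lie_mem_sumSpaces {S T R : Set (Module.Dual k h)}
    (hR : ∀ α ∈ S, ∀ β ∈ T, α + β ∈ R) {x y : Alg D} (hx : x ∈ sumSpaces D S)
    (hy : y ∈ sumSpaces D T) : ⁅x, y⁆ ∈ sumSpaces D R := by
  have h1 : sumSpaces D S ≤
      (sumSpaces D R).comap ((LieAlgebra.ad k (Alg D)).toLinearMap.flip y) := by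
    refine iSup₂_le fun α hα x hx => ?_
    have h2 : sumSpaces D T ≤ (sumSpaces D R).comap (LieAlgebra.ad k (Alg D) x) :=
      iSup₂_le fun β hβ y hy =>
        rootSpace_le_sumSpaces D (hR α hα β hβ) (lie_mem_rootSpace D hx hy)
    exact h2 hy
  exact h1 hx

theorem sumSpaces_univ : sumSpaces D Set.univ = ⊤ := by
  let K : LieSubalgebra k (Alg D) :=
    { sumSpaces D Set.univ with
      lie_mem' := fun hx hy => lie_mem_sumSpaces D (fun _ _ _ _ => Set.mem_univ _) hx hy }
  have hK : K = ⊤ := eq_top_of_generators D K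
    (fun t => rootSpace_le_sumSpaces D (Set.mem_univ _) (H_mem_rootSpace D t))
    (fun i => rootSpace_le_sumSpaces D (Set.mem_univ _) (e_mem_rootSpace D i))
    (fun i => rootSpace_le_sumSpaces D (Set.mem_univ _) (f_mem_rootSpace D i))
  rw [eq_top_iff]
  intro x _
  have : x ∈ K := hK ▸ LieSubalgebra.mem_top x
  exact this

theorem iSupIndep_rootSpace : iSupIndep (rootSpace D) := by
  have h1 := Module.End.independent_iInf_maxGenEigenspace_of_forall_mapsTo
    (fun t : h => (LieAlgebra.ad k (Alg D) (H D t) : Module.End k (Alg D))) (by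
      intro t t' φ
      apply Module.End.mapsTo_maxGenEigenspace_of_comm
      rw [commute_iff_lie_eq, ← LieHom.map_lie, lie_HH, map_zero])
  have h2 := h1.comp (f := fun α : Module.Dual k h => (α : h → k)) DFunLike.coe_injective
  refine h2.mono fun α x hx => ?_
  simp only [Function.comp_apply, Submodule.mem_iInf]
  intro t
  refine Module.End.mem_maxGenEigenspace _ _ _ |>.2 ⟨1, ?_⟩
  have := hx t
  simp [this]

theorem disjoint_sumSpaces {S T : Set (Module.Dual k h)} (hST : Disjoint S T) :
    Disjoint (sumSpaces D S) (sumSpaces D T) :=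
  (iSupIndep_rootSpace D).disjoint_biSup_biSup hST

theorem isCompl_sumSpaces (S : Set (Module.Dual k h)) :
    IsCompl (sumSpaces D S) (sumSpaces D Sᶜ) where
  disjoint := disjoint_sumSpaces D disjoint_compl_right
  codisjoint := by
    rw [codisjoint_iff, ← sumSpaces_union, Set.union_compl_self, sumSpaces_univ]

/-! The triangular decomposition. -/

theorem lie_H_mem_lieSpan (x : Fin n → Alg D) (φ : Fin n → h → k)
    (hx : ∀ t i, ⁅H D t, x i⁆ = φ i t • x i) (t : h) {y : Alg D}
    (hy : y ∈ LieSubalgebra.lieSpan k (Alg D) (Set.range x)) :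
    ⁅H D t, y⁆ ∈ LieSubalgebra.lieSpan k (Alg D) (Set.range x) := by
  induction hy using LieSubalgebra.lieSpan_induction with
  | mem y hy =>
    obtain ⟨i, rfl⟩ := hy
    rw [hx]
    exact (LieSubalgebra.lieSpan k (Alg D) (Set.range x)).smul_mem _
      (LieSubalgebra.subset_lieSpan ⟨i, rfl⟩)
  | zero => rw [lie_zero]; exact zero_mem _
  | add y z _ _ hy hz => rw [lie_add]; exact add_mem hy hz
  | smul c y _ hy => rw [lie_smul]; exact LieSubalgebra.smul_mem _ _ hy
  | lie y z hy' hz' hy hz =>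
    rw [leibniz_lie]
    exact add_mem (LieSubalgebra.lie_mem _ hy hz') (LieSubalgebra.lie_mem _ hy' hz)

theorem lie_opp_mem (x y : Fin n → Alg D) (φ : Fin n → h → k)
    (hy : ∀ t i, ⁅H D t, y i⁆ = φ i t • y i)
    (hxy : ∀ i j, ⁅x i, y j⁆ ∈ LinearMap.range (H D)) (i : Fin n) {z : Alg D}
    (hz : z ∈ LieSubalgebra.lieSpan k (Alg D) (Set.range y)) :
    ⁅x i, z⁆ ∈ LinearMap.range (H D) ⊔
      (LieSubalgebra.lieSpan k (Alg D) (Set.range y)).toSubmodule := by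
  have key : ∀ u ∈ LinearMap.range (H D) ⊔
      (LieSubalgebra.lieSpan k (Alg D) (Set.range y)).toSubmodule,
      ∀ z ∈ LieSubalgebra.lieSpan k (Alg D) (Set.range y),
      ⁅u, z⁆ ∈ LieSubalgebra.lieSpan k (Alg D) (Set.range y) := by
    intro u hu z hz
    obtain ⟨_, ⟨t, rfl⟩, v, hv, rfl⟩ := Submodule.mem_sup.1 hu
    rw [add_lie]
    exact add_mem (lie_H_mem_lieSpan D y φ hy t hz) (LieSubalgebra.lie_mem _ hv hz)
  induction hz using LieSubalgebra.lieSpan_induction with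
  | mem z hz =>
    obtain ⟨j, rfl⟩ := hz
    exact Submodule.mem_sup_left (hxy i j)
  | zero => rw [lie_zero]; exact zero_mem _
  | add y z _ _ hy hz => rw [lie_add]; exact add_mem hy hz
  | smul c y _ hy => rw [lie_smul]; exact Submodule.smul_mem _ _ hy
  | lie y z hy' hz' hy hz =>
    rw [leibniz_lie]
    refine Submodule.mem_sup_right (add_mem (key _ hy _ hz') ?_)
    rw [← lie_skew]
    exact neg_mem (key _ hz _ hy')

theorem lie_EF_mem (i j : Fin n) : ⁅e D i, f D j⁆ ∈ LinearMap.range (H D) := by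
  by_cases hij : i = j
  · subst hij
    exact ⟨_, (lie_EF_same D i).symm⟩
  · rw [lie_EF_ne D i j hij]
    exact zero_mem _

theorem lie_FE_mem (i j : Fin n) : ⁅f D i, e D j⁆ ∈ LinearMap.range (H D) := by
  rw [← lie_skew]
  exact neg_mem (lie_EF_mem D j i)

theorem lie_HF' (x : h) (i : Fin n) : ⁅H D x, f D i⁆ = (fun i t => -D.root i t) i x • f D i := by
  rw [lie_HF, neg_smul]

theorem triangular :
    (LieSubalgebra.lieSpan k (Alg D) (Set.range (e D))).toSubmodule ⊔ LinearMap.range (H D) ⊔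
      (LieSubalgebra.lieSpan k (Alg D) (Set.range (f D))).toSubmodule = ⊤ := by
  set P := LieSubalgebra.lieSpan k (Alg D) (Set.range (e D))
  set N := LieSubalgebra.lieSpan k (Alg D) (Set.range (f D))
  set V := P.toSubmodule ⊔ LinearMap.range (H D) ⊔ N.toSubmodule with hV
  have hP : P.toSubmodule ≤ V := le_sup_left.trans le_sup_left
  have hH : LinearMap.range (H D) ≤ V := le_sup_right.trans le_sup_left
  have hN : N.toSubmodule ≤ V := le_sup_right
  have he : ∀ i, e D i ∈ P := fun i => LieSubalgebra.subset_lieSpan ⟨i, rfl⟩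
  have hf : ∀ i, f D i ∈ N := fun i => LieSubalgebra.subset_lieSpan ⟨i, rfl⟩
  -- stability of `V` under `ad x`, for `x` in the subalgebra `K`
  let K : LieSubalgebra k (Alg D) :=
    { carrier := {x | ∀ v ∈ V, ⁅x, v⁆ ∈ V}
      add_mem' := fun hx hy v hv => by rw [add_lie]; exact add_mem (hx v hv) (hy v hv)
      zero_mem' := fun v _ => by rw [zero_lie]; exact zero_mem _
      smul_mem' := fun c x hx v hv => by rw [smul_lie]; exact Submodule.smul_mem _ _ (hx v hv)
      lie_mem' := fun hx hy v hv => by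
        rw [lie_lie]
        exact sub_mem (hx _ (hy v hv)) (hy _ (hx v hv)) }
  have hsplit : ∀ x : Alg D, (∀ v ∈ P, ⁅x, v⁆ ∈ V) → (∀ t, ⁅x, H D t⁆ ∈ V) →
      (∀ v ∈ N, ⁅x, v⁆ ∈ V) → x ∈ K := by
    intro x h1 h2 h3 v hv
    obtain ⟨a, ha, c, hc, rfl⟩ := Submodule.mem_sup.1 hv
    obtain ⟨a, ha', _, ⟨t, rfl⟩, rfl⟩ := Submodule.mem_sup.1 ha
    rw [lie_add, lie_add]
    exact add_mem (add_mem (h1 a ha') (h2 t)) (h3 c hc)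
  have hK : K = ⊤ := by
    refine eq_top_of_generators D K (fun t => ?_) (fun i => ?_) (fun i => ?_)
    · refine hsplit _ (fun v hv => ?_) (fun t' => ?_) (fun v hv => ?_)
      · exact hP (lie_H_mem_lieSpan D (e D) _ (lie_HE D) t hv)
      · rw [lie_HH]; exact zero_mem _
      · exact hN (lie_H_mem_lieSpan D (f D) _ (lie_HF' D) t hv)
    · refine hsplit _ (fun v hv => ?_) (fun t' => ?_) (fun v hv => ?_)
      · exact hP (P.lie_mem (he i) hv)
      · rw [← lie_skew, lie_HE]
        exact neg_mem (V.smul_mem _ (hP (he i)))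
      · exact sup_le hH hN (lie_opp_mem D (e D) (f D) _ (lie_HF' D) (lie_EF_mem D) i hv)
    · refine hsplit _ (fun v hv => ?_) (fun t' => ?_) (fun v hv => ?_)
      · exact sup_le hH hP (lie_opp_mem D (f D) (e D) _ (lie_HE D) (lie_FE_mem D) i hv)
      · rw [← lie_skew, lie_HF, neg_neg]
        exact V.smul_mem _ (hN (hf i))
      · exact hN (N.lie_mem (hf i) hv)
  let V' : LieSubalgebra k (Alg D) :=
    { V with
      lie_mem' := fun {x y} _ hy => by
        have : x ∈ K := hK ▸ LieSubalgebra.mem_top x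
        exact this y hy }
  have hV' : V' = ⊤ := eq_top_of_generators D V' (fun t => hH ⟨t, rfl⟩)
    (fun i => hP (he i)) (fun i => hN (hf i))
  rw [eq_top_iff]
  intro x _
  have : x ∈ V' := hV' ▸ LieSubalgebra.mem_top x
  exact this

/-- The weight `∑ z i • α_i`. -/
def wt (z : Fin n → ℤ) : Module.Dual k h := ∑ i, z i • D.root i

theorem wt_add (z w : Fin n → ℤ) : wt D (z + w) = wt D z + wt D w := by
  simp [wt, add_smul, Finset.sum_add_distrib]

theorem wt_units_smul (s : ℤˣ) (z : Fin n → ℤ) :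
    wt D (fun i => s * z i) = (s : ℤ) • wt D z := by
  simp [wt, Finset.smul_sum, mul_smul]

theorem wt_single (i : Fin n) : wt D (Pi.single i 1) = D.root i := by
  simp [wt, Pi.single_apply]

theorem wt_injective [CharZero k] : Function.Injective (wt D) := by
  intro z w hzw
  have h1 : ∑ i, ((z i : k) - (w i : k)) • D.root i = 0 := by
    have h2 : ∀ i, ((z i : k) - (w i : k)) • D.root i = z i • D.root i - w i • D.root i := by
      intro i
      rw [← Int.cast_smul_eq_zsmul k, ← Int.cast_smul_eq_zsmul k, ← sub_smul]
    rw [Finset.sum_congr rfl fun i _ => h2 i, Finset.sum_sub_distrib]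
    exact sub_eq_zero.2 hzw
  have h2 := Fintype.linearIndependent_iff.1 D.linInd_root _ h1
  funext i
  exact_mod_cast sub_eq_zero.1 (h2 i)

/-- Nonzero sums of simple roots, up to the sign `s`. -/
def cone (s : ℤˣ) : Set (Module.Dual k h) :=
  wt D '' {z | (∀ i, 0 ≤ (s : ℤ) * z i) ∧ z ≠ 0}

theorem lieSpan_le_cone [CharZero k] (s : ℤˣ) (x : Fin n → Alg D)
    (hx : ∀ i, x i ∈ rootSpace D ((s : ℤ) • D.root i)) :
    (LieSubalgebra.lieSpan k (Alg D) (Set.range x)).toSubmodule ≤ sumSpaces D (cone D s) := by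
  let K : LieSubalgebra k (Alg D) :=
    { sumSpaces D (cone D s) with
      lie_mem' := fun ha hb => by
        refine lie_mem_sumSpaces D ?_ ha hb
        rintro _ ⟨z, ⟨hz, hz0⟩, rfl⟩ _ ⟨w, ⟨hw, hw0⟩, rfl⟩
        refine ⟨z + w, ⟨fun i => ?_, fun h0 => hz0 ?_⟩, wt_add D z w⟩
        · rw [Pi.add_apply, mul_add]
          exact add_nonneg (hz i) (hw i)
        · funext i
          have h1 := hz i
          have h2 := hw i
          have h3 : z i + w i = 0 := congrFun h0 i
          rcases Int.units_eq_one_or s with rfl | rfl <;> simp at h1 h2 ⊢ <;> omega }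
  have : LieSubalgebra.lieSpan k (Alg D) (Set.range x) ≤ K := by
    rw [LieSubalgebra.lieSpan_le]
    rintro _ ⟨i, rfl⟩
    refine rootSpace_le_sumSpaces D ?_ (hx i)
    refine ⟨fun j => s * (Pi.single i 1 : Fin n → ℤ) j, ⟨fun j => ?_, fun h0 => ?_⟩, ?_⟩
    · rw [← mul_assoc, ← Units.val_mul, Int.units_mul_self]
      by_cases hj : j = i
      · subst hj; simp
      · simp [hj]
    · have := congrFun h0 i
      simp at this
    · rw [wt_units_smul, wt_single]
  exact this

theorem triangular_cone [CharZero k] :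
    sumSpaces D (cone D 1) ⊔ LinearMap.range (H D) ⊔ sumSpaces D (cone D (-1)) = ⊤ := by
  rw [eq_top_iff, ← triangular D]
  refine sup_le_sup (sup_le_sup (lieSpan_le_cone D 1 _ fun i => ?_) le_rfl)
    (lieSpan_le_cone D (-1) _ fun i => ?_)
  · simpa using e_mem_rootSpace D i
  · simpa using f_mem_rootSpace D i

theorem cone_ne_zero [CharZero k] {s : ℤˣ} {α : Module.Dual k h} (hα : α ∈ cone D s) :
    α ≠ 0 := by
  rintro rfl
  obtain ⟨z, ⟨-, hz⟩, h0⟩ := hα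
  exact hz (wt_injective D (h0.trans (by simp [wt])))

theorem range_H_le : LinearMap.range (H D) ≤ rootSpace D 0 := by
  rintro _ ⟨t, rfl⟩
  exact H_mem_rootSpace D t

theorem rootSpace_zero [CharZero k] : rootSpace D 0 = LinearMap.range (H D) := by
  refine le_antisymm (fun x hx => ?_) (range_H_le D)
  have hx' : x ∈ sumSpaces D (cone D 1) ⊔ LinearMap.range (H D) ⊔ sumSpaces D (cone D (-1)) :=
    triangular_cone D ▸ Submodule.mem_top
  obtain ⟨_, hab, c, hc, rfl⟩ := Submodule.mem_sup.1 hx'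
  obtain ⟨a, ha, b, hb, rfl⟩ := Submodule.mem_sup.1 hab
  have h1 : a + c ∈ sumSpaces D (cone D 1 ∪ cone D (-1)) := by
    rw [sumSpaces_union]
    exact add_mem (Submodule.mem_sup_left ha) (Submodule.mem_sup_right hc)
  have h2 : a + c ∈ sumSpaces D {0} := by
    refine rootSpace_le_sumSpaces D (Set.mem_singleton _) ?_
    have := sub_mem hx (range_H_le D hb)
    have h3 : a + b + c - b = a + c := by abel
    rwa [h3] at this
  have h3 : Disjoint (cone D 1 ∪ cone D (-1)) {0} := by
    rw [Set.disjoint_singleton_right]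
    rintro (h | h) <;> exact cone_ne_zero D h rfl
  have h4 : a + c = 0 := Submodule.disjoint_def.1 (disjoint_sumSpaces D h3) _ h1 h2
  have h5 : a + b + c = b := by rw [add_right_comm, h4, zero_add]
  rwa [h5]

theorem signedRoots_of_roots [CharZero k] {α : Module.Dual k h} (hα : α ∈ roots D) (s : ℤˣ) :
    α ∈ signedRoots D s ∨ α ∈ signedRoots D (-s) := by
  have h1 : α ∈ cone D 1 ∪ cone D (-1) := by
    by_contra hα'
    apply hα.2
    have h2 : Disjoint ({α} : Set (Module.Dual k h)) (cone D 1 ∪ {0} ∪ cone D (-1)) := by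
      rw [Set.disjoint_singleton_left]
      rintro ((h | h) | h)
      · exact hα' (Or.inl h)
      · exact hα.1 h
      · exact hα' (Or.inr h)
    have h3 := disjoint_sumSpaces D h2
    have h4 : sumSpaces D (cone D 1 ∪ {0} ∪ cone D (-1)) = ⊤ := by
      rw [eq_top_iff, ← triangular_cone D, sumSpaces_union, sumSpaces_union]
      refine sup_le_sup (sup_le_sup le_rfl ?_) le_rfl
      exact (range_H_le D).trans (rootSpace_le_sumSpaces D (Set.mem_singleton _))
    rw [h4, disjoint_top] at h3
    rw [eq_bot_iff, ← h3]
    exact rootSpace_le_sumSpaces D (Set.mem_singleton _)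
  have key : ∀ s : ℤˣ, α ∈ cone D s → α ∈ signedRoots D s := by
    rintro s ⟨z, ⟨hz, -⟩, rfl⟩
    refine ⟨hα, fun i => ((s : ℤ) * z i).toNat, ?_⟩
    have : ∀ i, (((s : ℤ) * z i).toNat : ℤ) = s * z i := fun i => Int.toNat_of_nonneg (hz i)
    have h5 : ∑ i, ((s : ℤ) * z i).toNat • D.root i = wt D fun i => s * z i := by
      refine Finset.sum_congr rfl fun i _ => ?_
      rw [← natCast_zsmul, this i]
    rw [h5, wt_units_smul, ← mul_smul, ← Units.val_mul, Int.units_mul_self]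
    simp
  rcases Int.units_eq_one_or s with rfl | rfl
  · exact h1.imp (key 1) (key (-1))
  · rw [neg_neg]
    exact h1.symm.imp (key (-1)) (key 1)

theorem rootLattice_eq : rootLattice D Ξ = wt D '' {z | ∀ i ∉ Ξ, z i = 0} := by
  ext α
  exact ⟨fun ⟨z, hz, h⟩ => ⟨z, hz, h.symm⟩, fun ⟨z, hz, h⟩ => ⟨z, hz, h.symm⟩⟩

/-- The weights which are sums of elements of `s • Π` and `ℤΞ`. -/
def parabolicCone : Set (Module.Dual k h) := wt D '' {z | ∀ i ∉ Ξ, 0 ≤ (s : ℤ) * z i}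

theorem signedRoots_sub : signedRoots D s ⊆ parabolicCone D Ξ s := by
  rintro _ ⟨-, a, rfl⟩
  refine ⟨fun i => s * (a i : ℤ), fun i _ => ?_, ?_⟩
  · rw [← mul_assoc, ← Units.val_mul, Int.units_mul_self]
    simp
  · rw [wt_units_smul]
    simp [wt]

theorem rootLattice_sub : rootLattice D Ξ ⊆ parabolicCone D Ξ s := by
  rw [rootLattice_eq]
  exact Set.image_mono fun z hz i hi => by simp [hz i hi]

theorem zero_mem_rootLattice : (0 : Module.Dual k h) ∈ rootLattice D Ξ :=
  ⟨0, fun _ _ => rfl, by simp⟩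

theorem mem_lattice_of_opp [CharZero k] {α : Module.Dual k h} (h1 : α ∈ parabolicCone D Ξ s)
    (h2 : α ∈ signedRoots D (-s)) : α ∈ rootLattice D Ξ := by
  obtain ⟨z, hz, rfl⟩ := h1
  obtain ⟨w, hw, hzw⟩ := signedRoots_sub D Ξ (-s) h2
  obtain rfl := wt_injective D hzw
  rw [rootLattice_eq]
  refine ⟨w, fun i hi => ?_, rfl⟩
  have h3 := hz i hi
  have h4 := hw i hi
  rcases Int.units_eq_one_or s with rfl | rfl <;> simp at h3 h4 <;> omega

theorem sumSpaces_le_of_roots {S : Set (Module.Dual k h)} {K : Submodule k (Alg D)}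
    (h0 : (0 : Module.Dual k h) ∈ S → rootSpace D 0 ≤ K)
    (hS : ∀ α ∈ S, α ∈ roots D → rootSpace D α ≤ K) : sumSpaces D S ≤ K := by
  refine iSup₂_le fun α hα => ?_
  by_cases hα0 : α = 0
  · subst hα0
    exact h0 hα
  by_cases hb : rootSpace D α = ⊥
  · rw [hb]
    exact bot_le
  · exact hS α hα ⟨hα0, hb⟩

theorem leviSpace_eq [CharZero k] : leviSpace D Ξ = sumSpaces D (rootLattice D Ξ) := by
  refine le_antisymm (sup_le ?_ (sumSpaces_mono D Set.inter_subset_right))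
    (sumSpaces_le_of_roots D ?_ ?_)
  · exact (range_H_le D).trans (rootSpace_le_sumSpaces D (zero_mem_rootLattice D Ξ))
  · rw [rootSpace_zero]
    exact fun _ => le_sup_left
  · exact fun α h1 h2 => (rootSpace_le_sumSpaces D (S := leviRoots D Ξ) ⟨h2, h1⟩).trans le_sup_right

theorem parabolicSpace_eq [CharZero k] :
    parabolicSpace D Ξ s = sumSpaces D (parabolicCone D Ξ s) := by
  refine le_antisymm (sup_le (sup_le ?_ ?_) ?_) (sumSpaces_le_of_roots D ?_ ?_)
  · exact sumSpaces_mono D fun α hα => rootLattice_sub D Ξ s hα.1.2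
  · exact (range_H_le D).trans
      (rootSpace_le_sumSpaces D (rootLattice_sub D Ξ s (zero_mem_rootLattice D Ξ)))
  · exact sumSpaces_mono D (signedRoots_sub D Ξ s)
  · rw [rootSpace_zero]
    exact fun _ => le_sup_right.trans le_sup_left
  · intro α h1 h2
    rcases signedRoots_of_roots D h2 s with h3 | h3
    · exact (rootSpace_le_sumSpaces D h3).trans le_sup_right
    · exact (rootSpace_le_sumSpaces D
        (S := leviRoots D Ξ ∩ signedRoots D (-s)) ⟨⟨h2, mem_lattice_of_opp D Ξ s h1 h3⟩, h3⟩).trans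
        (le_sup_left.trans le_sup_left)

theorem nilSpace_eq [CharZero k] :
    nilSpace D Ξ s = sumSpaces D (parabolicCone D Ξ s \ rootLattice D Ξ) := by
  refine le_antisymm (sumSpaces_mono D ?_) (sumSpaces_le_of_roots D ?_ ?_)
  · exact fun α hα => ⟨signedRoots_sub D Ξ s hα.1, fun h' => hα.2 ⟨⟨hα.1.1, h'⟩, hα.1⟩⟩
  · exact fun h' => absurd (zero_mem_rootLattice D Ξ) h'.2
  · intro α h1 h2
    refine rootSpace_le_sumSpaces D ?_
    rcases signedRoots_of_roots D h2 s with h3 | h3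
    · exact ⟨h3, fun h4 => h1.2 h4.1.2⟩
    · exact absurd (mem_lattice_of_opp D Ξ s h1.1 h3) h1.2

theorem lattice_add {α β : Module.Dual k h} (hα : α ∈ rootLattice D Ξ)
    (hβ : β ∈ rootLattice D Ξ) : α + β ∈ rootLattice D Ξ := by
  rw [rootLattice_eq] at *
  obtain ⟨z, hz, rfl⟩ := hα
  obtain ⟨w, hw, rfl⟩ := hβ
  exact ⟨z + w, fun i hi => by simp [hz i hi, hw i hi], wt_add D z w⟩

theorem parabolicCone_add {α β : Module.Dual k h} (hα : α ∈ parabolicCone D Ξ s)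
    (hβ : β ∈ parabolicCone D Ξ s) : α + β ∈ parabolicCone D Ξ s := by
  obtain ⟨z, hz, rfl⟩ := hα
  obtain ⟨w, hw, rfl⟩ := hβ
  refine ⟨z + w, fun i hi => ?_, wt_add D z w⟩
  rw [Pi.add_apply, mul_add]
  exact add_nonneg (hz i hi) (hw i hi)

theorem nil_add [CharZero k] {α β : Module.Dual k h} (hα : α ∈ parabolicCone D Ξ s)
    (hβ : β ∈ parabolicCone D Ξ s \ rootLattice D Ξ) :
    α + β ∈ parabolicCone D Ξ s \ rootLattice D Ξ := by
  refine ⟨parabolicCone_add D Ξ s hα hβ.1, fun h' => hβ.2 ?_⟩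
  obtain ⟨z, hz, rfl⟩ := hα
  obtain ⟨⟨w, hw, rfl⟩, -⟩ := hβ
  rw [← wt_add, rootLattice_eq] at h'
  obtain ⟨v, hv, hvw⟩ := h'
  obtain rfl := wt_injective D hvw
  rw [rootLattice_eq]
  refine ⟨w, fun i hi => ?_, rfl⟩
  have h1 := hz i hi
  have h2 := hw i hi
  have h3 : z i + w i = 0 := hv i hi
  rcases Int.units_eq_one_or s with rfl | rfl <;> simp at h1 h2 <;> omega

theorem parabolicSpace_eq_sup [CharZero k] :
    parabolicSpace D Ξ s = leviSpace D Ξ ⊔ nilSpace D Ξ s := by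
  rw [parabolicSpace_eq, leviSpace_eq, nilSpace_eq, ← sumSpaces_union,
    Set.union_sdiff_cancel (rootLattice_sub D Ξ s)]

theorem lie_mem_leviSpace [CharZero k] {x y : Alg D} (hx : x ∈ leviSpace D Ξ)
    (hy : y ∈ leviSpace D Ξ) : ⁅x, y⁆ ∈ leviSpace D Ξ := by
  rw [leviSpace_eq] at *
  exact lie_mem_sumSpaces D (fun _ hα _ hβ => lattice_add D Ξ hα hβ) hx hy

theorem lie_mem_parabolicSpace [CharZero k] {x y : Alg D} (hx : x ∈ parabolicSpace D Ξ s)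
    (hy : y ∈ parabolicSpace D Ξ s) : ⁅x, y⁆ ∈ parabolicSpace D Ξ s := by
  rw [parabolicSpace_eq] at *
  exact lie_mem_sumSpaces D (fun _ hα _ hβ => parabolicCone_add D Ξ s hα hβ) hx hy

theorem lie_mem_nilSpace [CharZero k] {x y : Alg D} (hx : x ∈ parabolicSpace D Ξ s)
    (hy : y ∈ nilSpace D Ξ s) : ⁅x, y⁆ ∈ nilSpace D Ξ s := by
  rw [parabolicSpace_eq, nilSpace_eq] at *
  exact lie_mem_sumSpaces D (fun _ hα _ hβ => nil_add D Ξ s hα hβ) hx hy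


/-! The transpose anti-involution. -/

/-- The morphism from the free Lie algebra inducing the Chevalley involution. -/
def freeChevalley : FreeLieAlgebra k (Gen h n) →ₗ⁅k⁆ Aux D :=
  FreeLieAlgebra.lift k fun
    | .H x => -auxOf D (.H x)
    | .e i => -auxOf D (.f i)
    | .f i => -auxOf D (.e i)

theorem freeChevalley_H (x : h) : freeChevalley D (gen D (.H x)) = -auxOf D (.H x) :=
  FreeLieAlgebra.lift_of_apply ..

theorem freeChevalley_e (i : Fin n) : freeChevalley D (gen D (.e i)) = -auxOf D (.f i) :=
  FreeLieAlgebra.lift_of_apply ..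

theorem freeChevalley_f (i : Fin n) : freeChevalley D (gen D (.f i)) = -auxOf D (.e i) :=
  FreeLieAlgebra.lift_of_apply ..

theorem freeChevalley_relator {x : FreeLieAlgebra k (Gen h n)} (hx : Relator D x) :
    freeChevalley D x = 0 := by
  cases hx with
  | add x y =>
    have : auxOf D (.H (x + y)) = _ := map_add (auxH D) x y
    simp only [map_sub, map_add, freeChevalley_H, this, auxH, LinearMap.coe_mk, AddHom.coe_mk]
    abel
  | smul c x =>
    have : auxOf D (.H (c • x)) = _ := map_smul (auxH D) c x
    simp only [map_sub, map_smul, freeChevalley_H, this, auxH, LinearMap.coe_mk, AddHom.coe_mk]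
    simp
  | HH x y => rw [LieHom.map_lie, freeChevalley_H, freeChevalley_H, neg_lie, lie_neg, aux_HH]; simp
  | HE x i =>
    rw [map_sub, LieHom.map_lie, map_smul, freeChevalley_H, freeChevalley_e, neg_lie, lie_neg,
      aux_HF]
    simp
  | HF x i =>
    rw [map_add, LieHom.map_lie, map_smul, freeChevalley_H, freeChevalley_f, neg_lie, lie_neg,
      aux_HE]
    simp
  | EF_same i =>
    rw [map_sub, LieHom.map_lie, freeChevalley_H, freeChevalley_e, freeChevalley_f, neg_lie,
      lie_neg, ← lie_skew, aux_EF_same]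
    simp
  | EF_ne i j hij =>
    rw [LieHom.map_lie, freeChevalley_e, freeChevalley_f, neg_lie,
      lie_neg, ← lie_skew, aux_EF_ne D j i hij.symm]
    simp

theorem relIdeal_le_ker : relIdeal D ≤ (freeChevalley D).ker := by
  rw [relIdeal, LieSubmodule.lieSpan_le]
  exact fun x hx => freeChevalley_relator D hx

/-- The Chevalley involution of `𝔤̃(A)`. -/
def auxChevalley : Aux D →ₗ⁅k⁆ Aux D where
  toLinearMap := (relIdeal D).toSubmodule.liftQ (freeChevalley D : FreeLieAlgebra k (Gen h n) →ₗ[k] Aux D)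
    fun _ hx => LieHom.mem_ker.1 (relIdeal_le_ker D hx)
  map_lie' {x y} := by
    obtain ⟨x, rfl⟩ := auxQuot_surjective D x
    obtain ⟨y, rfl⟩ := auxQuot_surjective D y
    exact (freeChevalley D).map_lie x y

theorem auxChevalley_auxQuot (x : FreeLieAlgebra k (Gen h n)) :
    auxChevalley D (auxQuot D x) = freeChevalley D x := rfl

theorem auxChevalley_auxChevalley (x : Aux D) : auxChevalley D (auxChevalley D x) = x := by
  obtain ⟨x, rfl⟩ := auxQuot_surjective D x
  have : ((auxChevalley D).comp (auxChevalley D)).comp (auxQuot D) = auxQuot D := by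
    apply FreeLieAlgebra.hom_ext
    intro x
    change auxChevalley D (freeChevalley D (gen D x)) = auxOf D x
    cases x with
    | H x =>
      rw [freeChevalley_H, map_neg, auxOf, auxChevalley_auxQuot, freeChevalley_H, neg_neg, auxOf]
    | e i =>
      rw [freeChevalley_e, map_neg, auxOf, auxChevalley_auxQuot, freeChevalley_f, neg_neg]
    | f i =>
      rw [freeChevalley_f, map_neg, auxOf, auxChevalley_auxQuot, freeChevalley_e, neg_neg]
  exact LieHom.congr_fun this x

theorem auxChevalley_radical {x : Aux D} (hx : x ∈ radical D) :
    auxChevalley D x ∈ radical D := by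
  have : radical D ≤ (radical D).comap (auxChevalley D) := by
    refine sSup_le fun I hI x hx => ?_
    rw [LieIdeal.mem_comap]
    have hJ : I.comap (auxChevalley D) ≤ radical D := by
      refine le_sSup fun t ht => hI t ?_
      rw [LieIdeal.mem_comap, auxOf, auxChevalley_auxQuot, freeChevalley_H] at ht
      simpa using neg_mem ht
    apply hJ
    rw [LieIdeal.mem_comap, auxChevalley_auxChevalley]
    exact hx
  exact LieIdeal.mem_comap.1 (this hx)

/-- The Chevalley involution of `𝔤(A)`: `e i ↦ -f i`, `f i ↦ -e i` and `t ↦ -t` on `𝔥`. -/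
def chevalley : Alg D →ₗ⁅k⁆ Alg D where
  toLinearMap := (radical D).toSubmodule.liftQ
    (((quot D).comp (auxChevalley D) : Aux D →ₗ⁅k⁆ Alg D) : Aux D →ₗ[k] Alg D)
    fun _ hx => (quot_eq_zero D).2 (auxChevalley_radical D hx)
  map_lie' {x y} := by
    obtain ⟨x, rfl⟩ := quot_surjective D x
    obtain ⟨y, rfl⟩ := quot_surjective D y
    exact ((quot D).comp (auxChevalley D)).map_lie x y

theorem chevalley_quot (x : Aux D) : chevalley D (quot D x) = quot D (auxChevalley D x) := rfl

theorem chevalley_H (t : h) : chevalley D (H D t) = -H D t := by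
  change quot D (freeChevalley D (gen D (.H t))) = _
  rw [freeChevalley_H, map_neg]
  rfl

theorem chevalley_e (i : Fin n) : chevalley D (e D i) = -f D i := by
  change quot D (freeChevalley D (gen D (.e i))) = _
  rw [freeChevalley_e, map_neg]
  rfl

theorem chevalley_f (i : Fin n) : chevalley D (f D i) = -e D i := by
  change quot D (freeChevalley D (gen D (.f i))) = _
  rw [freeChevalley_f, map_neg]
  rfl

theorem chevalley_chevalley (x : Alg D) : chevalley D (chevalley D x) = x := by
  obtain ⟨x, rfl⟩ := quot_surjective D x
  rw [chevalley_quot, chevalley_quot, auxChevalley_auxChevalley]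

end Algebra

section Enveloping

attribute [local instance 100] LieRing.ofAssociativeRing

variable {L L' : Type u} [LieRing L] [LieAlgebra k L] [LieRing L'] [LieAlgebra k L']

theorem enveloping_induction {P : UniversalEnvelopingAlgebra k L → Prop}
    (hι : ∀ x, P (UniversalEnvelopingAlgebra.ι k x)) (halg : ∀ c : k, P (algebraMap k _ c))
    (hmul : ∀ X Y, P X → P Y → P (X * Y)) (hadd : ∀ X Y, P X → P Y → P (X + Y)) (X) : P X := by
  let S : Subalgebra k (UniversalEnvelopingAlgebra k L) :=
    { carrier := {X | P X}
      mul_mem' := fun hX hY => hmul _ _ hX hY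
      add_mem' := fun hX hY => hadd _ _ hX hY
      algebraMap_mem' := halg }
  let g : L →ₗ⁅k⁆ S :=
    { toFun := fun x => ⟨UniversalEnvelopingAlgebra.ι k x, hι x⟩
      map_add' := fun x y => Subtype.ext (map_add _ x y)
      map_smul' := fun c x => Subtype.ext (map_smul _ c x)
      map_lie' := fun {x y} => Subtype.ext (LieHom.map_lie _ x y) }
  have hF : S.val.comp (UniversalEnvelopingAlgebra.lift k g) = AlgHom.id k _ := by
    apply UniversalEnvelopingAlgebra.hom_ext
    ext x
    change S.val (UniversalEnvelopingAlgebra.lift k g (UniversalEnvelopingAlgebra.ι k x)) =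
      UniversalEnvelopingAlgebra.ι k x
    rw [UniversalEnvelopingAlgebra.lift_ι_apply]
    rfl
  have := congrArg (fun F => F X) hF
  change S.val (UniversalEnvelopingAlgebra.lift k g X) = X at this
  rw [← this]
  exact (UniversalEnvelopingAlgebra.lift k g X).2

/-- The algebra morphism `U𝔩 → U𝔩'` induced by a morphism `𝔩 → 𝔩'` of Lie algebras. -/
def envMap (g : L →ₗ⁅k⁆ L') :
    UniversalEnvelopingAlgebra k L →ₐ[k] UniversalEnvelopingAlgebra k L' :=
  UniversalEnvelopingAlgebra.lift k ((UniversalEnvelopingAlgebra.ι k).comp g)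

theorem envMap_ι (g : L →ₗ⁅k⁆ L') (x : L) :
    envMap g (UniversalEnvelopingAlgebra.ι k x) = UniversalEnvelopingAlgebra.ι k (g x) :=
  UniversalEnvelopingAlgebra.lift_ι_apply ..

theorem envMap_comp {L'' : Type u} [LieRing L''] [LieAlgebra k L''] (g : L' →ₗ⁅k⁆ L'')
    (g' : L →ₗ⁅k⁆ L') (X : UniversalEnvelopingAlgebra k L) :
    envMap g (envMap g' X) = envMap (g.comp g') X := by
  have : (envMap g).comp (envMap g') = envMap (g.comp g') := by
    apply UniversalEnvelopingAlgebra.hom_ext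
    ext x
    change envMap g (envMap g' (UniversalEnvelopingAlgebra.ι k x)) =
      envMap (g.comp g') (UniversalEnvelopingAlgebra.ι k x)
    simp only [envMap_ι, LieHom.comp_apply]
  exact congrArg (fun F => F X) this

theorem envMap_id (X : UniversalEnvelopingAlgebra k L) : envMap (LieHom.id : L →ₗ⁅k⁆ L) X = X := by
  have : envMap (LieHom.id : L →ₗ⁅k⁆ L) = AlgHom.id k _ := by
    apply UniversalEnvelopingAlgebra.hom_ext
    ext x
    change envMap (LieHom.id : L →ₗ⁅k⁆ L) (UniversalEnvelopingAlgebra.ι k x) =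
      UniversalEnvelopingAlgebra.ι k x
    simp only [envMap_ι, LieHom.id_apply]
  exact congrArg (fun F => F X) this

variable (D : Datum k h n)

/-- The enveloping algebra `U𝔤`. -/
abbrev Ug : Type u := UniversalEnvelopingAlgebra k (Alg D)

/-- The transpose anti-involution of `U𝔤`, as a morphism to the opposite algebra. -/
def tauOp : Ug D →ₐ[k] (Ug D)ᵐᵒᵖ :=
  UniversalEnvelopingAlgebra.lift k
    { toFun := fun x => MulOpposite.op (UniversalEnvelopingAlgebra.ι k (-chevalley D x))
      map_add' := fun x y => by simp only [map_add, neg_add, MulOpposite.op_add]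
      map_smul' := fun c x => by
        simp only [map_smul, ← smul_neg, MulOpposite.op_smul, RingHom.id_apply]
      map_lie' := fun {x y} => by
        simp only [LieHom.map_lie, map_neg, LieRing.of_associative_ring_bracket,
          ← MulOpposite.op_mul, ← MulOpposite.op_sub]
        simp }

/-- The transpose anti-involution of `U𝔤`. -/
def tau (X : Ug D) : Ug D := (tauOp D X).unop

theorem tau_ι (x : Alg D) : tau D (UniversalEnvelopingAlgebra.ι k x) =
    UniversalEnvelopingAlgebra.ι k (-chevalley D x) := by
  rw [tau, tauOp, UniversalEnvelopingAlgebra.lift_ι_apply]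
  rfl

theorem tau_e (i : Fin n) : tau D (UniversalEnvelopingAlgebra.ι k (e D i)) =
    UniversalEnvelopingAlgebra.ι k (f D i) := by
  rw [tau_ι, chevalley_e, neg_neg]

theorem tau_f (i : Fin n) : tau D (UniversalEnvelopingAlgebra.ι k (f D i)) =
    UniversalEnvelopingAlgebra.ι k (e D i) := by
  rw [tau_ι, chevalley_f, neg_neg]

theorem tau_H (t : h) : tau D (UniversalEnvelopingAlgebra.ι k (H D t)) =
    UniversalEnvelopingAlgebra.ι k (H D t) := by
  rw [tau_ι, chevalley_H, neg_neg]

theorem tau_mul (X Y : Ug D) : tau D (X * Y) = tau D Y * tau D X := by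
  rw [tau, map_mul]
  rfl

theorem tau_add (X Y : Ug D) : tau D (X + Y) = tau D X + tau D Y := by
  rw [tau, map_add]
  rfl

theorem tau_algebraMap (c : k) : tau D (algebraMap k _ c) = algebraMap k _ c := by
  rw [tau, AlgHom.commutes]
  rfl

theorem tau_one : tau D 1 = 1 := by
  rw [tau, map_one]
  rfl

theorem tau_zero : tau D 0 = 0 := by
  rw [tau, map_zero]
  rfl

theorem tau_tau (X : Ug D) : tau D (tau D X) = X := by
  induction X using enveloping_induction with
  | hι x => rw [tau_ι, tau_ι, map_neg (chevalley D), neg_neg, chevalley_chevalley]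
  | halg c => rw [tau_algebraMap, tau_algebraMap]
  | hmul X Y hX hY => rw [tau_mul, tau_mul, hX, hY]
  | hadd X Y hX hY => rw [tau_add, tau_add, hX, hY]

end Enveloping

section Parabolic

variable [CharZero k] (D : Datum k h n) (Ξ : Set (Fin n)) (s : ℤˣ)

/-- The Levi subalgebra `𝔩_Ξ`. -/
def levi : LieSubalgebra k (Alg D) :=
  { leviSpace D Ξ with lie_mem' := lie_mem_leviSpace D Ξ }

/-- The parabolic subalgebra `𝔭⁺_Ξ` (for `s = 1`), resp. `𝔭⁻_Ξ` (for `s = -1`). -/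
def parabolic : LieSubalgebra k (Alg D) :=
  { parabolicSpace D Ξ s with lie_mem' := lie_mem_parabolicSpace D Ξ s }

theorem nil_le_parabolic {x : Alg D} (hx : x ∈ nilSpace D Ξ s) : x ∈ parabolicSpace D Ξ s := by
  rw [parabolicSpace_eq_sup]
  exact Submodule.mem_sup_right hx

/-- The nilradical `𝔲⁺_Ξ` (for `s = 1`) of `𝔭⁺_Ξ`, resp. `𝔲⁻_Ξ` (for `s = -1`) of `𝔭⁻_Ξ`. -/
def nilradical : LieSubalgebra k (Alg D) :=
  { nilSpace D Ξ s with
    lie_mem' := fun hx hy => lie_mem_nilSpace D Ξ s (nil_le_parabolic D Ξ s hx) hy }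

theorem levi_le_parabolic : levi D Ξ ≤ parabolic D Ξ s := by
  intro x hx
  change x ∈ parabolicSpace D Ξ s
  rw [parabolicSpace_eq_sup]
  exact Submodule.mem_sup_left hx

theorem mem_parabolic_iff {x : Alg D} : x ∈ parabolic D Ξ s ↔
    ∃ y ∈ levi D Ξ, ∃ z ∈ nilradical D Ξ s, y + z = x := by
  change x ∈ parabolicSpace D Ξ s ↔ _
  rw [parabolicSpace_eq_sup]
  exact Submodule.mem_sup

theorem isCompl_leviSpace :
    IsCompl (leviSpace D Ξ) (sumSpaces D (rootLattice D Ξ)ᶜ) := by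
  rw [leviSpace_eq]
  exact isCompl_sumSpaces D _

theorem nilSpace_le : nilSpace D Ξ s ≤ sumSpaces D (rootLattice D Ξ)ᶜ := by
  rw [nilSpace_eq]
  exact sumSpaces_mono D fun _ hα => hα.2

/-- The linear projection of `𝔤` onto `𝔩_Ξ`, killing the other root spaces. -/
def projLin : Alg D →ₗ[k] leviSpace D Ξ :=
  Submodule.projectionOnto _ _ (isCompl_leviSpace D Ξ)

theorem projLin_add (y z : Alg D) (hy : y ∈ leviSpace D Ξ) (hz : z ∈ nilSpace D Ξ s) :
    projLin D Ξ (y + z) = ⟨y, hy⟩ := by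
  rw [projLin, map_add, Submodule.projectionOnto_apply_of_mem_left _ hy,
    Submodule.projectionOnto_apply_of_mem_right _ (nilSpace_le D Ξ s hz), add_zero]

/-- The projection `𝔭^s_Ξ = 𝔩_Ξ ⊕ 𝔲^s_Ξ → 𝔩_Ξ`. -/
def leviProj : parabolic D Ξ s →ₗ⁅k⁆ levi D Ξ where
  toFun x := projLin D Ξ x
  map_add' x y := map_add (projLin D Ξ) _ _
  map_smul' c x := map_smul (projLin D Ξ) c _
  map_lie' := by
    rintro ⟨x, hx⟩ ⟨x', hx'⟩
    obtain ⟨y, hy, z, hz, rfl⟩ := (mem_parabolic_iff D Ξ s).1 hx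
    obtain ⟨y', hy', z', hz', rfl⟩ := (mem_parabolic_iff D Ξ s).1 hx'
    change projLin D Ξ ⁅y + z, y' + z'⁆ = _
    have h1 : ⁅y + z, y' + z'⁆ = ⁅y, y'⁆ + (⁅y + z, z'⁆ - ⁅y', z⁆) := by
      rw [lie_add, add_lie, add_lie, ← lie_skew y' z]
      abel
    have h2 : ⁅y + z, z'⁆ - ⁅y', z⁆ ∈ nilSpace D Ξ s :=
      sub_mem (lie_mem_nilSpace D Ξ s hx hz')
        (lie_mem_nilSpace D Ξ s (levi_le_parabolic D Ξ s hy') hz)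
    rw [h1, projLin_add D Ξ s _ _ (lie_mem_leviSpace D Ξ hy hy') h2]
    apply Subtype.ext
    change _ = ⁅((projLin D Ξ (y + z) : leviSpace D Ξ) : Alg D),
      ((projLin D Ξ (y' + z') : leviSpace D Ξ) : Alg D)⁆
    rw [projLin_add D Ξ s y z hy hz, projLin_add D Ξ s y' z' hy' hz']

theorem leviProj_inclusion (x : levi D Ξ) :
    leviProj D Ξ s (LieSubalgebra.inclusion (levi_le_parabolic D Ξ s) x) = x := by
  have := projLin_add D Ξ s x 0 x.2 (zero_mem _)
  rw [add_zero] at this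
  exact this

theorem leviProj_nil (x : Alg D) (hx : x ∈ nilradical D Ξ s) :
    leviProj D Ξ s ⟨x, nil_le_parabolic D Ξ s hx⟩ = 0 := by
  have := projLin_add D Ξ s 0 x (zero_mem _) hx
  rw [zero_add] at this
  exact this

theorem sub_leviProj_mem (x : parabolic D Ξ s) :
    (x : Alg D) - (leviProj D Ξ s x : Alg D) ∈ nilradical D Ξ s := by
  obtain ⟨x, hx⟩ := x
  obtain ⟨y, hy, z, hz, rfl⟩ := (mem_parabolic_iff D Ξ s).1 hx
  change (y + z) - ((projLin D Ξ (y + z) : leviSpace D Ξ) : Alg D) ∈ _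
  rw [projLin_add D Ξ s y z hy hz]
  simpa using hz

end Parabolic

/-! Images of natural transformations, and change of rings over noncommutative rings. -/

section Generic

variable {R S T : Type u} [Ring R] [Ring S] [Ring T]

section Image

variable {C : Type*} [Category C] {F G : C ⥤ ModuleCat.{u} R} (η : F ⟶ G)

/-- The image of a natural transformation of functors with values in modules. -/
def imageFunctor : C ⥤ ModuleCat.{u} R where
  obj X := ModuleCat.of R (LinearMap.range (η.app X).hom)
  map {X Y} g := ModuleCat.ofHom ((G.map g).hom.restrict (by
    rintro _ ⟨x, rfl⟩
    exact ⟨(F.map g).hom x, congrArg (fun φ => φ.hom x) (η.naturality g)⟩))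
  map_id X := by
    refine ModuleCat.hom_ext (LinearMap.ext fun x => Subtype.ext ?_)
    exact congrArg (fun φ => φ.hom x.1) (G.map_id X)
  map_comp g g' := by
    refine ModuleCat.hom_ext (LinearMap.ext fun x => Subtype.ext ?_)
    exact congrArg (fun φ => φ.hom x.1) (G.map_comp g g')

/-- The inclusion of the image of a natural transformation into its target. -/
def imageι : imageFunctor η ⟶ G where
  app X := ModuleCat.ofHom (LinearMap.range (η.app X).hom).subtype
  naturality _ _ _ := rfl

end Image

section Tensor

variable (j : R →+* S) (q : R →+* T)

/-- The `S`-submodule of `S ⊗_ℤ N` generated by the elements `a r ⊗ x - a ⊗ r x` for `r : R`. -/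
def balanced (N : Type u) [AddCommGroup N] [Module T N] : Submodule S (S ⊗[ℤ] N) :=
  Submodule.span S {y | ∃ (a : S) (r : R) (x : N), y = (a * j r) ⊗ₜ x - a ⊗ₜ (q r • x)}

/-- The tensor product `S ⊗_R N` for `R → S` and a `T`-module `N`, viewed as an `R`-module through
`R → T`. -/
abbrev BalTensor (N : Type u) [AddCommGroup N] [Module T N] : Type u :=
  (S ⊗[ℤ] N) ⧸ balanced j q N

variable {N : Type u} [AddCommGroup N] [Module T N]

/-- The pure tensors in `S ⊗_R N`. -/
def tmk (a : S) (x : N) : BalTensor j q N := (balanced j q N).mkQ (a ⊗ₜ x)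

theorem tmk_balanced (a : S) (r : R) (x : N) : tmk j q (a * j r) x = tmk j q a (q r • x) := by
  rw [tmk, tmk, ← sub_eq_zero, ← map_sub]
  exact (Submodule.Quotient.mk_eq_zero _).2 (Submodule.subset_span ⟨a, r, x, rfl⟩)

theorem smul_tmk (b a : S) (x : N) : b • tmk j q a x = tmk j q (b * a) x := rfl

theorem tmk_add (a : S) (x y : N) : tmk j q a (x + y) = tmk j q a x + tmk j q a y := by
  rw [tmk, TensorProduct.tmul_add, map_add]
  rfl

variable {M : Type u} [AddCommGroup M] [Module S M]

/-- The universal property of `S ⊗_R N`. -/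
def tlift (g : N →+ M) (hg : ∀ r x, g (q r • x) = j r • g x) : BalTensor j q N →ₗ[S] M :=
  (balanced j q N).liftQ 
    (TensorProduct.AlgebraTensorModule.lift
      (LinearMap.toSpanSingleton S (N →ₗ[ℤ] M) g.toIntLinearMap)) (by
    rw [balanced, Submodule.span_le]
    rintro _ ⟨a, r, x, rfl⟩
    change TensorProduct.AlgebraTensorModule.lift _ _ = 0
    rw [map_sub, TensorProduct.AlgebraTensorModule.lift_tmul,
      TensorProduct.AlgebraTensorModule.lift_tmul]
    change (a * j r) • g x - a • g (q r • x) = 0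
    rw [hg, mul_smul, sub_self])

theorem tlift_tmk (g : N →+ M) (hg : ∀ r x, g (q r • x) = j r • g x) (a : S) (x : N) :
    tlift j q g hg (tmk j q a x) = a • g x :=
  TensorProduct.AlgebraTensorModule.lift_tmul
    (LinearMap.toSpanSingleton S (N →ₗ[ℤ] M) g.toIntLinearMap) a x

theorem BalTensor.hom_ext {φ ψ : BalTensor j q N →ₗ[S] M}
    (hφ : ∀ x, φ (tmk j q 1 x) = ψ (tmk j q 1 x)) : φ = ψ := by
  refine Submodule.linearMap_qext _ (LinearMap.ext fun y => ?_)
  induction y with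
  | zero => rw [map_zero, map_zero]
  | add y z hy hz => rw [map_add, map_add, hy, hz]
  | tmul a x =>
    have h1 : (φ ∘ₗ (balanced j q N).mkQ) (a ⊗ₜ x) = φ (a • tmk j q 1 x) := by
      rw [smul_tmk, mul_one]; rfl
    have h2 : (ψ ∘ₗ (balanced j q N).mkQ) (a ⊗ₜ x) = ψ (a • tmk j q 1 x) := by
      rw [smul_tmk, mul_one]; rfl
    rw [h1, h2, map_smul, map_smul, hφ]

/-- The functoriality of `S ⊗_R N` in `N`. -/
def tmap {N' : Type u} [AddCommGroup N'] [Module T N'] (g : N →ₗ[T] N') :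
    BalTensor j q N →ₗ[S] BalTensor j q N' :=
  tlift j q
    { toFun := fun x => tmk j q 1 (g x)
      map_zero' := by rw [map_zero, tmk, TensorProduct.tmul_zero, map_zero]
      map_add' := fun x y => by rw [map_add, tmk_add] }
    fun r x => by
      change tmk j q 1 (g (q r • x)) = j r • tmk j q 1 (g x)
      rw [map_smul, ← tmk_balanced, smul_tmk, one_mul, mul_one]

theorem tmap_tmk {N' : Type u} [AddCommGroup N'] [Module T N'] (g : N →ₗ[T] N') (a : S) (x : N) :
    tmap j q g (tmk j q a x) = tmk j q a (g x) := by
  rw [tmap, tlift_tmk]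
  change a • tmk j q 1 (g x) = _
  rw [smul_tmk, mul_one]

/-- The functor `N ↦ S ⊗_R N`. -/
def tensorFunctor : ModuleCat.{u} T ⥤ ModuleCat.{u} S where
  obj N := ModuleCat.of S (BalTensor j q N)
  map g := ModuleCat.ofHom (tmap j q g.hom)
  map_id N := by
    refine ModuleCat.hom_ext (BalTensor.hom_ext j q fun x => ?_)
    exact tmap_tmk j q LinearMap.id 1 x
  map_comp g g' := by
    refine ModuleCat.hom_ext (BalTensor.hom_ext j q fun x => ?_)
    change tmap j q (g'.hom ∘ₗ g.hom) (tmk j q 1 x) = tmap j q g'.hom (tmap j q g.hom (tmk j q 1 x))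
    rw [tmap_tmk, tmap_tmk, tmap_tmk]
    rfl

end Tensor

end Generic

section Functors

attribute [local instance 100] LieRing.ofAssociativeRing

variable [CharZero k] (D : Datum k h n) (Ξ : Set (Fin n))

/-- The enveloping algebra `U𝔩_Ξ`. -/
abbrev Ul : Type u := UniversalEnvelopingAlgebra k (levi D Ξ)

/-- The enveloping algebra `U𝔭^s_Ξ`. -/
abbrev Up (s : ℤˣ) : Type u := UniversalEnvelopingAlgebra k (parabolic D Ξ s)

/-- The inclusion `U𝔩_Ξ → U𝔤`. -/
def inclL : Ul D Ξ →+* Ug D := (envMap (levi D Ξ).incl).toRingHom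

/-- The inclusion `U𝔭^s_Ξ → U𝔤`. -/
def inclP (s : ℤˣ) : Up D Ξ s →+* Ug D := (envMap (parabolic D Ξ s).incl).toRingHom

/-- The inclusion `U𝔩_Ξ → U𝔭^s_Ξ`. -/
def inclLP (s : ℤˣ) : Ul D Ξ →+* Up D Ξ s :=
  (envMap (LieSubalgebra.inclusion (levi_le_parabolic D Ξ s))).toRingHom

/-- The projection `U𝔭^s_Ξ → U𝔩_Ξ`. -/
def projP (s : ℤˣ) : Up D Ξ s →+* Ul D Ξ := (envMap (leviProj D Ξ s)).toRingHom

theorem inclP_inclLP (s : ℤˣ) (X : Ul D Ξ) : inclP D Ξ s (inclLP D Ξ s X) = inclL D Ξ X :=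
  envMap_comp ..

theorem projP_inclLP (s : ℤˣ) (X : Ul D Ξ) : projP D Ξ s (inclLP D Ξ s X) = X := by
  refine (envMap_comp _ _ X).trans ?_
  have : (leviProj D Ξ s).comp (LieSubalgebra.inclusion (levi_le_parabolic D Ξ s)) =
      LieHom.id := LieHom.ext fun x => leviProj_inclusion D Ξ s x
  rw [this, envMap_id]

/-- The canonical map `𝔤 → U𝔤`. -/
abbrev ιg (x : Alg D) : Ug D := UniversalEnvelopingAlgebra.ι k x

theorem ιg_lie (x y : Alg D) : ιg D x * ιg D y = ιg D y * ιg D x + ιg D ⁅x, y⁆ := by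
  rw [ιg, ιg, ιg, LieHom.map_lie, LieRing.of_associative_ring_bracket]
  abel

/-- The forgetful functor from `𝔤`-modules to `𝔩_Ξ`-modules. -/
abbrev oblv : ModuleCat.{u} (Ug D) ⥤ ModuleCat.{u} (Ul D Ξ) :=
  ModuleCat.restrictScalars (inclL D Ξ)

section Modules

variable (M : ModuleCat.{u} (Ug D))

theorem invariants_smul (X : Ul D Ξ) (m : M)
    (hm : ∀ x ∈ nilradical D Ξ 1, ιg D x • m = 0) :
    ∀ x ∈ nilradical D Ξ 1, ιg D x • inclL D Ξ X • m = 0 := by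
  induction X using enveloping_induction generalizing m with
  | hι y =>
    intro x hx
    have h1 : inclL D Ξ (UniversalEnvelopingAlgebra.ι k y) = ιg D y := envMap_ι ..
    have h2 : ⁅x, (y : Alg D)⁆ ∈ nilradical D Ξ 1 := by
      rw [← lie_skew]
      exact neg_mem (lie_mem_nilSpace D Ξ 1 (levi_le_parabolic D Ξ 1 y.2) hx)
    rw [h1, ← mul_smul, ιg_lie, add_smul, mul_smul, hm x hx, hm _ h2, smul_zero, add_zero]
  | halg c =>
    intro x hx
    have h1 : inclL D Ξ (algebraMap k _ c) = algebraMap k _ c :=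
      (envMap (levi D Ξ).incl).commutes c
    rw [h1, ← mul_smul, ← Algebra.commutes, mul_smul, hm x hx, smul_zero]
  | hmul X Y hX hY =>
    rw [map_mul]
    simp only [mul_smul]
    exact hX _ (hY _ hm)
  | hadd X Y hX hY =>
    intro x hx
    rw [map_add, add_smul, smul_add, hX m hm x hx, hY m hm x hx, add_zero]

/-- The `𝔲⁺_Ξ`-invariants of `M`, as an `𝔩_Ξ`-submodule. -/
def invariants : Submodule (Ul D Ξ) ((oblv D Ξ).obj M) where
  carrier := {m : M | ∀ x ∈ nilradical D Ξ 1, ιg D x • m = 0}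
  zero_mem' := fun x _ => smul_zero (A := M) (ιg D x)
  add_mem' := fun {m m'} hm hm' x hx => by
    have := smul_add (A := M) (ιg D x) m m'
    exact this.trans (by rw [hm x hx, hm' x hx, add_zero])
  smul_mem' := fun X m hm => invariants_smul D Ξ M X m hm

/-- The additive subgroup `𝔲⁻_Ξ M` of `M`. -/
def nilAct : AddSubgroup M :=
  AddSubgroup.closure {y | ∃ x ∈ nilradical D Ξ (-1), ∃ m : M, y = ιg D x • m}

theorem nilAct_smul (X : Ul D Ξ) (m : M) (hm : m ∈ nilAct D Ξ M) :
    inclL D Ξ X • m ∈ nilAct D Ξ M := by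
  induction X using enveloping_induction generalizing m with
  | hι y =>
    have h1 : inclL D Ξ (UniversalEnvelopingAlgebra.ι k y) = ιg D y := envMap_ι ..
    rw [h1]
    induction hm using AddSubgroup.closure_induction with
    | mem z hz =>
      obtain ⟨x, hx, m, rfl⟩ := hz
      rw [← mul_smul, ιg_lie, add_smul, mul_smul]
      exact add_mem (AddSubgroup.subset_closure ⟨x, hx, _, rfl⟩)
        (AddSubgroup.subset_closure
          ⟨_, lie_mem_nilSpace D Ξ (-1) (levi_le_parabolic D Ξ (-1) y.2) hx, _, rfl⟩)
    | zero => rw [smul_zero]; exact zero_mem _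
    | add a b _ _ ha hb => rw [smul_add]; exact add_mem ha hb
    | neg a _ ha => rw [smul_neg]; exact neg_mem ha
  | halg c =>
    have h1 : inclL D Ξ (algebraMap k _ c) = algebraMap k _ c :=
      (envMap (levi D Ξ).incl).commutes c
    rw [h1]
    induction hm using AddSubgroup.closure_induction with
    | mem z hz =>
      obtain ⟨x, hx, m, rfl⟩ := hz
      rw [← mul_smul, Algebra.commutes, mul_smul]
      exact AddSubgroup.subset_closure ⟨x, hx, _, rfl⟩
    | zero => rw [smul_zero]; exact zero_mem _
    | add a b _ _ ha hb => rw [smul_add]; exact add_mem ha hb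
    | neg a _ ha => rw [smul_neg]; exact neg_mem ha
  | hmul X Y hX hY =>
    rw [map_mul, mul_smul]
    exact hX _ (hY _ hm)
  | hadd X Y hX hY =>
    rw [map_add, add_smul]
    exact add_mem (hX _ hm) (hY _ hm)

/-- `𝔲⁻_Ξ M`, as an `𝔩_Ξ`-submodule of `M`. -/
def nilImage : Submodule (Ul D Ξ) ((oblv D Ξ).obj M) where
  carrier := {m : M | m ∈ nilAct D Ξ M}
  zero_mem' := zero_mem (nilAct D Ξ M)
  add_mem' := fun hm hm' => (nilAct D Ξ M).add_mem hm hm'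
  smul_mem' := fun X m hm => nilAct_smul D Ξ M X m hm

/-- The inclusion of the invariants into `M`, as an additive map. -/
def invVal : invariants D Ξ M →+ M := (invariants D Ξ M).subtype.toAddMonoidHom

theorem invVal_smul (X : Ul D Ξ) (m : invariants D Ξ M) :
    invVal D Ξ M (X • m) = inclL D Ξ X • invVal D Ξ M m := rfl

theorem smul_invVal {x : Alg D} (hx : x ∈ nilradical D Ξ 1) (m : invariants D Ξ M) :
    ιg D x • invVal D Ξ M m = 0 := m.2 x hx

/-- The coinvariants `M / 𝔲⁻_Ξ M`, with the `𝔩_Ξ`-action inherited from `M`. -/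
abbrev Coinvariants : Type u := ((oblv D Ξ).obj M : Type u) ⧸ nilImage D Ξ M

/-- The projection of `M` to the coinvariants, as an additive map. -/
def coinvMk : M →+ Coinvariants D Ξ M := (nilImage D Ξ M).mkQ.toAddMonoidHom

theorem smul_coinvMk (X : Ul D Ξ) (m : M) :
    X • coinvMk D Ξ M m = coinvMk D Ξ M (inclL D Ξ X • m) := rfl

theorem coinvMk_eq_zero {m : M} : coinvMk D Ξ M m = 0 ↔ m ∈ nilAct D Ξ M :=
  Submodule.Quotient.mk_eq_zero _

end Modules

/-- Parabolic `!`-restriction: `𝔲⁺_Ξ`-invariants. -/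
def resShriek : ModuleCat.{u} (Ug D) ⥤ ModuleCat.{u} (Ul D Ξ) where
  obj M := ModuleCat.of _ (invariants D Ξ M)
  map {M _} g := ModuleCat.ofHom (((oblv D Ξ).map g).hom.restrict fun m hm x hx =>
    (map_smul g.hom (ιg D x) (m : M)).symm.trans
      ((congrArg g.hom (hm x hx)).trans (map_zero g.hom)))
  map_id _ := rfl
  map_comp _ _ := rfl

theorem nilImage_le_comap {M M' : ModuleCat.{u} (Ug D)} (g : M ⟶ M') :
    nilImage D Ξ M ≤ (nilImage D Ξ M').comap ((oblv D Ξ).map g).hom := by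
  have : nilAct D Ξ M ≤ (nilAct D Ξ M').comap g.hom.toAddMonoidHom := by
    rw [nilAct, AddSubgroup.closure_le]
    rintro _ ⟨x, hx, m, rfl⟩
    exact AddSubgroup.subset_closure ⟨x, hx, g.hom m, map_smul g.hom _ _⟩
  exact fun m hm => @this m hm

/-- Parabolic `*`-restriction: `𝔲⁻_Ξ`-coinvariants. -/
def resStar : ModuleCat.{u} (Ug D) ⥤ ModuleCat.{u} (Ul D Ξ) where
  obj M := ModuleCat.of _ (Coinvariants D Ξ M)
  map {M M'} g := ModuleCat.ofHom
    ((nilImage D Ξ M).mapQ (nilImage D Ξ M') ((oblv D Ξ).map g).hom (nilImage_le_comap D Ξ g))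
  map_id _ := ModuleCat.hom_ext (Submodule.linearMap_qext _ rfl)
  map_comp _ _ := ModuleCat.hom_ext (Submodule.linearMap_qext _ rfl)

/-- The natural transformation from invariants to coinvariants, `m ↦ [m]`. -/
def resMap : resShriek D Ξ ⟶ resStar D Ξ where
  app M := ModuleCat.ofHom ((nilImage D Ξ M).mkQ ∘ₗ (invariants D Ξ M).subtype)
  naturality _ _ _ := rfl

/-- Intermediate parabolic restriction. -/
def resMid : ModuleCat.{u} (Ug D) ⥤ ModuleCat.{u} (Ul D Ξ) := imageFunctor (resMap D Ξ)

/-- Parabolic `!`-induction `N ↦ U𝔤 ⊗_{U𝔭⁺_Ξ} N`. -/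
def indShriek : ModuleCat.{u} (Ul D Ξ) ⥤ ModuleCat.{u} (Ug D) :=
  tensorFunctor (inclP D Ξ 1) (projP D Ξ 1)

/-- The group `Hom_{U𝔭⁻_Ξ}(U𝔤, N)`, where `Y : U𝔭⁻_Ξ` acts on `U𝔤` by `X ↦ X τ(Y)`, and on `N`
through the projection to `U𝔩_Ξ`. -/
def coind (N : Type u) [AddCommGroup N] [Module (Ul D Ξ) N] : AddSubgroup (Ug D →+ N) where
  carrier := {φ | ∀ (Y : Up D Ξ (-1)) (X : Ug D),
    φ (X * tau D (inclP D Ξ (-1) Y)) = projP D Ξ (-1) Y • φ X}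
  zero_mem' := fun Y X => by simp
  add_mem' := fun hφ hψ Y X => by
    rw [AddMonoidHom.add_apply, hφ, hψ, AddMonoidHom.add_apply, smul_add]
  neg_mem' := fun hφ Y X => by
    rw [AddMonoidHom.neg_apply, hφ, AddMonoidHom.neg_apply, smul_neg]

section Coind

variable (N : Type u) [AddCommGroup N] [Module (Ul D Ξ) N]

/-- The action of `Z : U𝔤` on `Hom_{U𝔭⁻_Ξ}(U𝔤, N)`, induced by the right action
`X ↦ τ(Z) X` of `U𝔤` on itself. -/
instance : SMul (Ug D) (coind D Ξ N) where
  smul Z φ := ⟨φ.1.comp (AddMonoidHom.mulLeft (tau D Z)), fun Y X => by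
    change φ.1 (tau D Z * (X * _)) = _ • φ.1 (tau D Z * X)
    rw [← mul_assoc, φ.2]⟩

variable {N}

theorem coind_smul_apply (Z : Ug D) (φ : coind D Ξ N) (X : Ug D) :
    (Z • φ).1 X = φ.1 (tau D Z * X) := rfl

theorem coind_ext {φ ψ : coind D Ξ N} (hφ : ∀ X, φ.1 X = ψ.1 X) : φ = ψ :=
  Subtype.ext (AddMonoidHom.ext hφ)

instance : Module (Ug D) (coind D Ξ N) where
  one_smul φ := coind_ext D Ξ fun X => by rw [coind_smul_apply, tau_one, one_mul]
  mul_smul Z W φ := coind_ext D Ξ fun X => by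
    rw [coind_smul_apply, coind_smul_apply, coind_smul_apply, tau_mul, mul_assoc]
  smul_zero Z := rfl
  smul_add Z φ ψ := rfl
  add_smul Z W φ := coind_ext D Ξ fun X => by
    rw [coind_smul_apply, tau_add, add_mul, map_add]
    rfl
  zero_smul φ := coind_ext D Ξ fun X => by
    rw [coind_smul_apply, tau_zero, zero_mul, map_zero]
    rfl

/-- The functoriality of coinduction. -/
def coindMap {N' : Type u} [AddCommGroup N'] [Module (Ul D Ξ) N'] (g : N →ₗ[Ul D Ξ] N') :
    coind D Ξ N →ₗ[Ug D] coind D Ξ N' where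
  toFun φ := ⟨g.toAddMonoidHom.comp φ.1, fun Y X => by
    change g (φ.1 _) = _ • g (φ.1 X)
    rw [φ.2, map_smul]⟩
  map_add' φ ψ := coind_ext D Ξ fun X => map_add g _ _
  map_smul' Z φ := rfl

end Coind

/-- Parabolic `*`-induction `N ↦ Hom_{U𝔭⁻_Ξ}(U𝔤, N)`. -/
def indStar : ModuleCat.{u} (Ul D Ξ) ⥤ ModuleCat.{u} (Ug D) where
  obj N := ModuleCat.of _ (coind D Ξ N)
  map g := ModuleCat.ofHom (coindMap D Ξ g.hom)
  map_id _ := rfl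
  map_comp _ _ := rfl

theorem projP_smul_invariants (M : ModuleCat.{u} (Ug D)) (Y : Up D Ξ 1) (m : invariants D Ξ M) :
    invVal D Ξ M (projP D Ξ 1 Y • m) = inclP D Ξ 1 Y • invVal D Ξ M m := by
  rw [invVal_smul]
  induction Y using enveloping_induction generalizing m with
  | hι y =>
    have h1 : projP D Ξ 1 (UniversalEnvelopingAlgebra.ι k y) =
      UniversalEnvelopingAlgebra.ι k (leviProj D Ξ 1 y) := envMap_ι ..
    have h2 : inclP D Ξ 1 (UniversalEnvelopingAlgebra.ι k y) = ιg D y := envMap_ι ..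
    have h3 : inclL D Ξ (UniversalEnvelopingAlgebra.ι k (leviProj D Ξ 1 y)) =
      ιg D (leviProj D Ξ 1 y) := envMap_ι ..
    have h4 := smul_invVal D Ξ M (sub_leviProj_mem D Ξ 1 y) m
    rw [ιg, map_sub, sub_smul, sub_eq_zero] at h4
    rw [h1, h2, h3, h4]
  | halg c =>
    have h1 : projP D Ξ 1 (algebraMap k _ c) = algebraMap k _ c :=
      (envMap (leviProj D Ξ 1)).commutes c
    have h2 : inclP D Ξ 1 (algebraMap k _ c) = algebraMap k _ c :=
      (envMap (parabolic D Ξ 1).incl).commutes c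
    have h3 : inclL D Ξ (algebraMap k _ c) = algebraMap k _ c :=
      (envMap (levi D Ξ).incl).commutes c
    rw [h1, h2, h3]
  | hmul X Y hX hY =>
    rw [map_mul, map_mul, map_mul, mul_smul, ← invVal_smul, hX, invVal_smul, hY, mul_smul]
  | hadd X Y hX hY =>
    rw [map_add, map_add, map_add, add_smul, add_smul, hX, hY]

/-- The map `Ind_! (Res^! M) → M`, `X ⊗ m ↦ X m`. -/
def counitShriekApp (M : ModuleCat.{u} (Ug D)) :
    BalTensor (inclP D Ξ 1) (projP D Ξ 1) (invariants D Ξ M) →ₗ[Ug D] M :=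
  tlift (inclP D Ξ 1) (projP D Ξ 1) (invVal D Ξ M) fun Y m => projP_smul_invariants D Ξ M Y m

theorem counitShriekApp_tmk (M : ModuleCat.{u} (Ug D)) (X : Ug D) (m : invariants D Ξ M) :
    counitShriekApp D Ξ M (tmk (inclP D Ξ 1) (projP D Ξ 1) X m) = X • invVal D Ξ M m :=
  tlift_tmk ..

/-- The counit of the adjunction `(Ind_!, Res^!)`: `X ⊗ m ↦ X m`. -/
def counitShriek : resShriek D Ξ ⋙ indShriek D Ξ ⟶ 𝟭 (ModuleCat.{u} (Ug D)) where
  app M := ModuleCat.ofHom (counitShriekApp D Ξ M)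
  naturality M M' g := by
    refine ModuleCat.hom_ext (BalTensor.hom_ext (inclP D Ξ 1) (projP D Ξ 1) fun m => ?_)
    change counitShriekApp D Ξ M' (tmap (inclP D Ξ 1) (projP D Ξ 1) ((resShriek D Ξ).map g).hom
      (tmk (inclP D Ξ 1) (projP D Ξ 1) 1 m)) =
      g.hom (counitShriekApp D Ξ M (tmk (inclP D Ξ 1) (projP D Ξ 1) 1 m))
    rw [tmap_tmk]
    have h1 := counitShriekApp_tmk D Ξ M' 1 (((resShriek D Ξ).map g).hom m)
    have h2 := counitShriekApp_tmk D Ξ M 1 m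
    exact h1.trans ((map_smul g.hom 1 (invVal D Ξ M m)).symm.trans (congrArg g.hom h2.symm))

theorem projP_smul_coinvariants (M : ModuleCat.{u} (Ug D)) (Y : Up D Ξ (-1)) (m : M) :
    projP D Ξ (-1) Y • coinvMk D Ξ M m = coinvMk D Ξ M (inclP D Ξ (-1) Y • m) := by
  induction Y using enveloping_induction generalizing m with
  | hι y =>
    have h1 : projP D Ξ (-1) (UniversalEnvelopingAlgebra.ι k y) =
      UniversalEnvelopingAlgebra.ι k (leviProj D Ξ (-1) y) := envMap_ι ..
    have h2 : inclP D Ξ (-1) (UniversalEnvelopingAlgebra.ι k y) = ιg D y := envMap_ι ..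
    have h3 : inclL D Ξ (UniversalEnvelopingAlgebra.ι k (leviProj D Ξ (-1) y)) =
      ιg D (leviProj D Ξ (-1) y) := envMap_ι ..
    rw [h1, h2, smul_coinvMk, h3, eq_comm, ← sub_eq_zero, ← map_sub, coinvMk_eq_zero, ← sub_smul,
      ιg, ιg, ← map_sub]
    exact AddSubgroup.subset_closure ⟨_, sub_leviProj_mem D Ξ (-1) y, m, rfl⟩
  | halg c =>
    have h1 : projP D Ξ (-1) (algebraMap k _ c) = algebraMap k _ c :=
      (envMap (leviProj D Ξ (-1))).commutes c
    have h2 : inclP D Ξ (-1) (algebraMap k _ c) = algebraMap k _ c :=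
      (envMap (parabolic D Ξ (-1)).incl).commutes c
    have h3 : inclL D Ξ (algebraMap k _ c) = algebraMap k _ c :=
      (envMap (levi D Ξ).incl).commutes c
    rw [h1, h2, smul_coinvMk, h3]
  | hmul X Y hX hY =>
    rw [map_mul, map_mul, mul_smul, hY, hX, mul_smul]
  | hadd X Y hX hY =>
    rw [map_add, map_add, add_smul, add_smul, hX, hY, map_add]

/-- The map `M → Ind_* (Res^* M)`, `m ↦ (X ↦ [τ(X) m])`. -/
def unitStarApp (M : ModuleCat.{u} (Ug D)) : M →ₗ[Ug D] coind D Ξ (Coinvariants D Ξ M) where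
  toFun m :=
    ⟨{  toFun := fun X => coinvMk D Ξ M (tau D X • m)
        map_zero' := by rw [tau_zero, zero_smul, map_zero]
        map_add' := fun X Y => by rw [tau_add, add_smul, map_add] },
      fun Y X => by
        change coinvMk D Ξ M (tau D (X * tau D _) • m) = _ • coinvMk D Ξ M (tau D X • m)
        rw [tau_mul, tau_tau, mul_smul, projP_smul_coinvariants]⟩
  map_add' m m' := coind_ext D Ξ fun X => by
    change coinvMk D Ξ M (tau D X • (m + m')) =
      coinvMk D Ξ M (tau D X • m) + coinvMk D Ξ M (tau D X • m')
    rw [smul_add, map_add]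
  map_smul' Z m := coind_ext D Ξ fun X => by
    change coinvMk D Ξ M (tau D X • Z • m) = coinvMk D Ξ M (tau D (tau D Z * X) • m)
    rw [tau_mul, tau_tau, mul_smul]

/-- The unit of the adjunction `(Res^*, Ind_*)`: `m ↦ (X ↦ [τ(X) m])`. -/
def unitStar : 𝟭 (ModuleCat.{u} (Ug D)) ⟶ resStar D Ξ ⋙ indStar D Ξ where
  app M := ModuleCat.ofHom (unitStarApp D Ξ M)
  naturality M M' g := by
    refine ModuleCat.hom_ext (LinearMap.ext fun m => coind_ext D Ξ fun X => ?_)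
    exact congrArg (coinvMk D Ξ M') (map_smul g.hom _ _).symm

/-- Evaluation at `1`, from `Hom_{U𝔭⁻_Ξ}(U𝔤, N)` to `N`. -/
def evalOne (N : ModuleCat.{u} (Ul D Ξ)) : (indStar D Ξ).obj N →+ N :=
  (AddMonoidHom.eval (1 : Ug D)).comp (coind D Ξ N).subtype

theorem evalOne_smul (N : ModuleCat.{u} (Ul D Ξ)) (Y : Up D Ξ (-1))
    (φ : (indStar D Ξ).obj N) :
    evalOne D Ξ N (inclP D Ξ (-1) Y • φ) = projP D Ξ (-1) Y • evalOne D Ξ N φ := by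
  have h1 := (φ : coind D Ξ N).2 Y 1
  rw [one_mul, ← mul_one (tau D _)] at h1
  exact h1

theorem evalOne_smul_levi (N : ModuleCat.{u} (Ul D Ξ)) (X : Ul D Ξ) (φ : (indStar D Ξ).obj N) :
    evalOne D Ξ N (inclL D Ξ X • φ) = X • evalOne D Ξ N φ := by
  have h1 := evalOne_smul D Ξ N (inclLP D Ξ (-1) X) φ
  rwa [inclP_inclLP, projP_inclLP] at h1

theorem evalOne_nilAct (N : ModuleCat.{u} (Ul D Ξ)) (φ : (indStar D Ξ).obj N)
    (hφ : φ ∈ nilAct D Ξ ((indStar D Ξ).obj N)) : evalOne D Ξ N φ = 0 := by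
  have h1 : nilAct D Ξ ((indStar D Ξ).obj N) ≤ (evalOne D Ξ N).ker := by
    rw [nilAct, AddSubgroup.closure_le]
    rintro _ ⟨x, hx, φ, rfl⟩
    have h1 := evalOne_smul D Ξ N
      (UniversalEnvelopingAlgebra.ι k ⟨x, nil_le_parabolic D Ξ (-1) hx⟩) φ
    have h2 : inclP D Ξ (-1) (UniversalEnvelopingAlgebra.ι k ⟨x, nil_le_parabolic D Ξ (-1) hx⟩) =
      ιg D x := envMap_ι ..
    have h3 : projP D Ξ (-1) (UniversalEnvelopingAlgebra.ι k ⟨x, nil_le_parabolic D Ξ (-1) hx⟩) =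
      UniversalEnvelopingAlgebra.ι k (leviProj D Ξ (-1) ⟨x, nil_le_parabolic D Ξ (-1) hx⟩) :=
      envMap_ι ..
    rw [h2, h3, leviProj_nil D Ξ (-1) x hx, map_zero, zero_smul] at h1
    exact h1
  exact h1 hφ

/-- The natural transformation `Res^! ∘ Ind_* → id`, `φ ↦ φ(1)`. -/
def evShriek : indStar D Ξ ⋙ resShriek D Ξ ⟶ 𝟭 (ModuleCat.{u} (Ul D Ξ)) where
  app N := ModuleCat.ofHom
    { toFun := fun φ => evalOne D Ξ N (invVal D Ξ ((indStar D Ξ).obj N) φ)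
      map_add' := fun _ _ => map_add (evalOne D Ξ N) _ _
      map_smul' := fun X _ => evalOne_smul_levi D Ξ N X _ }
  naturality _ _ _ := rfl

/-- The natural transformation `Res^* ∘ Ind_* → id`, `[φ] ↦ φ(1)`. It is the counit of the
adjunction `(Res^*, Ind_*)`. -/
def evStar : indStar D Ξ ⋙ resStar D Ξ ⟶ 𝟭 (ModuleCat.{u} (Ul D Ξ)) where
  app N := ModuleCat.ofHom ((nilImage D Ξ ((indStar D Ξ).obj N)).liftQ
    { toFun := fun φ => evalOne D Ξ N φ
      map_add' := fun _ _ => map_add (evalOne D Ξ N) _ _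
      map_smul' := fun X _ => evalOne_smul_levi D Ξ N X _ }
    fun φ hφ => evalOne_nilAct D Ξ N φ hφ)
  naturality _ _ _ := ModuleCat.hom_ext (Submodule.linearMap_qext _ rfl)

/-- The map `N → Res^* (Ind_! N)`, `x ↦ [1 ⊗ x]`. -/
def coevStarApp (N : ModuleCat.{u} (Ul D Ξ)) :
    N →ₗ[Ul D Ξ] Coinvariants D Ξ ((indShriek D Ξ).obj N) where
  toFun x := coinvMk D Ξ ((indShriek D Ξ).obj N) (tmk (inclP D Ξ 1) (projP D Ξ 1) 1 x)
  map_add' x y := by rw [tmk_add]; exact map_add _ _ _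
  map_smul' X x := by
    have h1 := tmk_balanced (inclP D Ξ 1) (projP D Ξ 1) 1 (inclLP D Ξ 1 X) x
    rw [projP_inclLP, inclP_inclLP, one_mul] at h1
    have h2 := smul_tmk (inclP D Ξ 1) (projP D Ξ 1) (inclL D Ξ X) 1 x
    rw [mul_one] at h2
    rw [← h1, ← h2]
    rfl

/-- The natural transformation `id → Res^* ∘ Ind_!`, `x ↦ [1 ⊗ x]`. -/
def coevStar : 𝟭 (ModuleCat.{u} (Ul D Ξ)) ⟶ indShriek D Ξ ⋙ resStar D Ξ where
  app N := ModuleCat.ofHom (coevStarApp D Ξ N)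
  naturality N N' g := by
    refine ModuleCat.hom_ext (LinearMap.ext fun x => ?_)
    exact congrArg (coinvMk D Ξ ((indShriek D Ξ).obj N'))
      (tmap_tmk (inclP D Ξ 1) (projP D Ξ 1) g.hom 1 x).symm

/-- The natural transformation `Ind_! = Ind_! ∘ Res^! ∘ Ind_* → Ind_*`, where the first
identification is the inverse of evaluation at `1`, and the second map is the counit. -/
def comparison [IsIso (evShriek D Ξ)] : indShriek D Ξ ⟶ indStar D Ξ :=
  (Functor.leftUnitor _).inv ≫ Functor.whiskerRight (inv (evShriek D Ξ)) (indShriek D Ξ) ≫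
    (Functor.associator _ _ _).hom ≫ Functor.whiskerLeft (indStar D Ξ) (counitShriek D Ξ) ≫
    (Functor.rightUnitor _).hom

/-- Minimal parabolic induction: the image of `Ind_! → Ind_*`. -/
def indMid [IsIso (evShriek D Ξ)] : ModuleCat.{u} (Ul D Ξ) ⥤ ModuleCat.{u} (Ug D) :=
  imageFunctor (comparison D Ξ)

end Functors

end KacMoody

end

/-!
Everything is reduced to one fact about a Lie algebra `L = a ⊕ b` split into two subalgebras, applied
to `a = 𝔲⁻_Ξ` and `b = 𝔭⁺_Ξ`: the space `U(a) ⊗ N` carries an action of `L` that extends a given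
action of `b` on `N` (`inducedRep`). It is built without the Poincaré--Birkhoff--Witt theorem. For
any `a`-module `W`, the space `W × Hom(b, W)` is again an `a`-module (`jetAction`), the formula being
dictated by the requirement that `w ↦ (w, x ↦ x w)` be `a`-linear. The `U(a)`-linear map from
`U(a) ⊗ N` to `W × Hom(b, W)`, for `W = U(a) ⊗ N`, that extends `v ↦ (1 ⊗ v, x ↦ 1 ⊗ x v)` therefore
provides the operators by which `b` acts (`jet`), and the bracket relation holds on `1 ⊗ N` and is
inherited along the action of `a`. The augmentation of `U(a)` then gives a map `U(a) ⊗ N → N` that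
kills `a (U(a) ⊗ N)` and sends `1 ⊗ v` to `v`; composed with `Ind_! N → U(𝔲⁻_Ξ) ⊗ N` it shows that
`coev` is injective (`exists_retraction`, `coevStarApp_injective`).

The opposite direction only uses `L = a + b`: a subgroup that contains a `b`-stable subgroup `V`
and is stable under `a` and scalars contains `U(L) V` (`enveloping_smul_mem_of_sup_eq_top`). With `a = 𝔲⁻_Ξ` and
`b = 𝔭⁺_Ξ` this gives `Ind_! N = 1 ⊗ N + 𝔲⁻_Ξ Ind_! N`, so `coev` is surjective. With
`a = 𝔭⁻_Ξ` and `b = 𝔲⁺_Ξ` it shows that an invariant `φ` in `Ind_* N` with `φ(1) = 0` vanishes, so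
`ev^!` is injective. For its surjectivity, the preimage of `x` is
`φ_x = (X ↦ coev⁻¹ [τ(X) (1 ⊗ x)])`, the image of the unit at `1 ⊗ x` under `Ind_* (coev⁻¹)`.

As `c (1 ⊗ x) = φ_x`, the two descriptions of `c` agree. The `φ_x` also give surjectivity of the
three transformations on `Ind_!*`. Invariants inject by the injectivity of `ev^!`; for coinvariants,
writing an element of the image as `c (1 ⊗ x + u)` with `u ∈ 𝔲⁻_Ξ Ind_! N`, its value at `1` is
`x`, so when this vanishes the element lies in `𝔲⁻_Ξ Ind_!* N` (`mem_nilAct_indMid`).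
-/

noncomputable section

namespace KacMoody

section Induced

attribute [local instance 100] LieRing.ofAssociativeRing

/-! ### Subgroups stable under a decomposition of a Lie algebra -/

variable {k : Type u} [Field k] {L : Type u} [LieRing L] [LieAlgebra k L]

theorem enveloping_smul_mem {M : Type*} [AddCommGroup M] [Module (UniversalEnvelopingAlgebra k L) M]
    (T : AddSubgroup M)
    (hk : ∀ (c : k), ∀ m ∈ T, algebraMap k (UniversalEnvelopingAlgebra k L) c • m ∈ T)
    (hL : ∀ (x : L), ∀ m ∈ T, UniversalEnvelopingAlgebra.ι k x • m ∈ T)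
    (X : UniversalEnvelopingAlgebra k L) {m : M} (hm : m ∈ T) : X • m ∈ T := by
  induction X using enveloping_induction generalizing m with
  | hι x => exact hL x m hm
  | halg c => exact hk c m hm
  | hmul X Y hX hY => rw [mul_smul]; exact hX (hY hm)
  | hadd X Y hX hY => rw [add_smul]; exact add_mem (hX hm) (hY hm)

/-- If `L = a + b`, a subgroup stable under `a` and scalars that contains a `b`-stable subgroup `V`
contains the whole `U(L)`-submodule generated by `V`. This is the spanning half of `U(L) = U(a) U(b)`. -/
theorem enveloping_smul_mem_of_sup_eq_top {M : Type*} [AddCommGroup M]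
    [Module (UniversalEnvelopingAlgebra k L) M] {a b : Submodule k L} (hab : a ⊔ b = ⊤)
    {V S : AddSubgroup M} (hVS : V ≤ S)
    (hSk : ∀ (c : k), ∀ m ∈ S, algebraMap k (UniversalEnvelopingAlgebra k L) c • m ∈ S)
    (hV : ∀ x ∈ b, ∀ m ∈ V, UniversalEnvelopingAlgebra.ι k x • m ∈ V)
    (hS : ∀ x ∈ a, ∀ m ∈ S, UniversalEnvelopingAlgebra.ι k x • m ∈ S)
    (X : UniversalEnvelopingAlgebra k L) {m : M} (hm : m ∈ V) : X • m ∈ S := by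
  -- `T` is the `U(a)`-submodule generated by `V`, and `T'` its part mapped to `T` by `L`; as `T'`
  -- contains `V` and is stable under `a`, it is all of `T`
  let C : Set (AddSubgroup M) := {T | V ≤ T ∧
    (∀ (c : k), ∀ m ∈ T, algebraMap k (UniversalEnvelopingAlgebra k L) c • m ∈ T) ∧
    ∀ x ∈ a, ∀ m ∈ T, UniversalEnvelopingAlgebra.ι k x • m ∈ T}
  let T := sInf C
  have hVT : V ≤ T := le_sInf fun U hU => hU.1
  have hTk : ∀ (c : k), ∀ m ∈ T, algebraMap k (UniversalEnvelopingAlgebra k L) c • m ∈ T :=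
    fun c m hm => AddSubgroup.mem_sInf.2 fun U hU =>
      hU.2.1 c m (AddSubgroup.mem_sInf.1 hm U hU)
  have hTa : ∀ x ∈ a, ∀ m ∈ T, UniversalEnvelopingAlgebra.ι k x • m ∈ T :=
    fun x hx m hm => AddSubgroup.mem_sInf.2 fun U hU =>
      hU.2.2 x hx m (AddSubgroup.mem_sInf.1 hm U hU)
  let T' : AddSubgroup M :=
    { carrier := {m | m ∈ T ∧ ∀ x : L, UniversalEnvelopingAlgebra.ι k x • m ∈ T}
      zero_mem' := ⟨zero_mem _, fun x => by rw [smul_zero]; exact zero_mem _⟩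
      add_mem' := fun hm hm' =>
        ⟨add_mem hm.1 hm'.1, fun x => by rw [smul_add]; exact add_mem (hm.2 x) (hm'.2 x)⟩
      neg_mem' := fun hm =>
        ⟨neg_mem hm.1, fun x => by rw [smul_neg]; exact neg_mem (hm.2 x)⟩ }
  have hT' : T' ∈ C := by
    refine ⟨fun m hm => ⟨hVT hm, fun x => ?_⟩, fun c m hm => ⟨hTk c m hm.1, fun x => ?_⟩,
      fun y hy m hm => ⟨hTa y hy m hm.1, fun x => ?_⟩⟩
    · obtain ⟨y, hy, z, hz, rfl⟩ := Submodule.mem_sup.1 (hab ▸ Submodule.mem_top : x ∈ a ⊔ b)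
      rw [map_add, add_smul]
      exact add_mem (hTa y hy m (hVT hm)) (hVT (hV z hz m hm))
    · rw [← mul_smul, ← Algebra.commutes, mul_smul]
      exact hTk c _ (hm.2 x)
    · have h1 : UniversalEnvelopingAlgebra.ι k x * UniversalEnvelopingAlgebra.ι k y =
          UniversalEnvelopingAlgebra.ι k y * UniversalEnvelopingAlgebra.ι k x +
            UniversalEnvelopingAlgebra.ι k ⁅x, y⁆ := by
        rw [LieHom.map_lie, LieRing.of_associative_ring_bracket]
        abel
      rw [← mul_smul, h1, add_smul, mul_smul]
      exact add_mem (hTa y hy _ (hm.2 x)) (hm.2 _)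
  have hTS : T ≤ S := sInf_le ⟨hVS, hSk, hS⟩
  exact hTS (enveloping_smul_mem T hTk
    (fun x m hm => (AddSubgroup.mem_sInf.1 hm T' hT' : m ∈ T').2 x) X (hVT hm))

/-! ### Representations induced along a decomposition into two subalgebras -/

variable {a b : LieSubalgebra k L} (hab : IsCompl a.toSubmodule b.toSubmodule)

/-- The projection of `L = a ⊕ b` onto `a`. -/
def fstProj : L →ₗ[k] a := Submodule.projectionOnto _ _ hab

/-- The projection of `L = a ⊕ b` onto `b`. -/
def sndProj : L →ₗ[k] b := Submodule.projectionOnto _ _ hab.symm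

theorem fstProj_add_sndProj (x : L) : (fstProj hab x : L) + sndProj hab x = x :=
  Submodule.projection_add_projection_eq_self hab x

theorem fstProj_fst (y : a) : fstProj hab y = y :=
  Submodule.projectionOnto_apply_left hab y

theorem sndProj_fst (y : a) : sndProj hab y = 0 :=
  Submodule.projectionOnto_apply_of_mem_right hab.symm y.2

theorem fstProj_snd (x : b) : fstProj hab x = 0 :=
  Submodule.projectionOnto_apply_of_mem_right hab x.2

theorem sndProj_snd (x : b) : sndProj hab x = x :=
  Submodule.projectionOnto_apply_left hab.symm x

variable {W : Type u} [AddCommGroup W] [Module k W] (θ : a →ₗ⁅k⁆ Module.End k W)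

/-- For a representation `θ` of `a` on `W`, the action of `a` on `W × Hom(b, W)` given by
`y (w, F) = (y w, x ↦ y F(x) + [x, y]_a w + F([x, y]_b))`, where the indices denote the components
in `L = a ⊕ b`. If the action on `W` came from one of
`L = a ⊕ b`, this would be the action making `w ↦ (w, x ↦ x w)` a morphism of `a`-modules. -/
def jetAction : a →ₗ⁅k⁆ Module.End k (W × (b →ₗ[k] W)) where
  toFun y :=
    { toFun := fun p => (θ y p.1,
        { toFun := fun x => θ y (p.2 x) + θ (fstProj hab ⁅(x : L), (y : L)⁆) p.1 +
            p.2 (sndProj hab ⁅(x : L), (y : L)⁆)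
          map_add' := fun x x' => by
            simp only [map_add, AddMemClass.coe_add, add_lie, LinearMap.add_apply]; abel
          map_smul' := fun c x => by
            simp only [map_smul, SetLike.val_smul, smul_lie, LinearMap.smul_apply,
              smul_add, RingHom.id_apply] })
      map_add' := fun p q => by
        refine Prod.ext (map_add _ _ _) (LinearMap.ext fun x => ?_)
        simp only [Prod.fst_add, Prod.snd_add, map_add, LinearMap.add_apply, LinearMap.coe_mk,
          AddHom.coe_mk]
        abel
      map_smul' := fun c p => by
        refine Prod.ext (map_smul _ _ _) (LinearMap.ext fun x => ?_)
        simp only [Prod.smul_fst, Prod.smul_snd, map_smul, LinearMap.smul_apply, LinearMap.coe_mk,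
          AddHom.coe_mk, smul_add, RingHom.id_apply] }
  map_add' y y' := by
    refine LinearMap.ext fun p => Prod.ext ?_ (LinearMap.ext fun x => ?_)
    · simp
    · simp only [map_add, AddMemClass.coe_add, lie_add, LinearMap.add_apply, LinearMap.coe_mk,
        AddHom.coe_mk, Prod.snd_add]
      abel
  map_smul' c y := by
    refine LinearMap.ext fun p => Prod.ext ?_ (LinearMap.ext fun x => ?_)
    · simp
    · simp only [map_smul, SetLike.val_smul, lie_smul, LinearMap.smul_apply,
        LinearMap.coe_mk, AddHom.coe_mk, Prod.smul_snd, smul_add, RingHom.id_apply]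
  map_lie' {y y'} := by
    refine LinearMap.ext fun p => Prod.ext ?_ (LinearMap.ext fun x => ?_)
    · simp [LieRing.of_associative_ring_bracket]
    · have h1 : ∀ z z' : a, (fstProj hab ⁅(z : L), (z' : L)⁆) = ⁅z, z'⁆ := fun z z' =>
        fstProj_fst hab ⁅z, z'⁆
      have h2 : ∀ z z' : a, (sndProj hab ⁅(z : L), (z' : L)⁆) = 0 := fun z z' =>
        sndProj_fst hab ⁅z, z'⁆
      have h3 : ⁅(x : L), ((⁅y, y'⁆ : a) : L)⁆ =
          ⁅(fstProj hab ⁅(x : L), (y : L)⁆ : L), (y' : L)⁆ +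
            ⁅(sndProj hab ⁅(x : L), (y : L)⁆ : L), (y' : L)⁆ -
          (⁅(fstProj hab ⁅(x : L), (y' : L)⁆ : L), (y : L)⁆ +
            ⁅(sndProj hab ⁅(x : L), (y' : L)⁆ : L), (y : L)⁆) := by
        rw [← add_lie, ← add_lie, fstProj_add_sndProj, fstProj_add_sndProj,
          LieSubalgebra.coe_bracket, leibniz_lie, ← lie_skew (y : L)]
        abel
      simp only [LinearMap.coe_mk, AddHom.coe_mk, h3, map_add, map_sub, h1, h2,
        LieRing.of_associative_ring_bracket, LinearMap.sub_apply, LinearMap.add_apply,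
        Module.End.mul_apply, Prod.snd_sub, LieHom.map_lie]
      simp only [map_zero]
      abel

variable {N : Type u} [AddCommGroup N] [Module k N] (π : b →ₗ⁅k⁆ Module.End k N)

/-- The space `U(a) ⊗ N` of the representation of `L = a ⊕ b` induced from the
representation `N` of `b`. -/
abbrev InducedSpace (a : LieSubalgebra k L) (N : Type u) [AddCommGroup N] [Module k N] : Type u :=
  UniversalEnvelopingAlgebra k a ⊗[k] N

/-- The action of `a` on `U(a) ⊗ N` by left multiplication. -/
def leftAction (a : LieSubalgebra k L) (N : Type u) [AddCommGroup N] [Module k N] :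
    a →ₗ⁅k⁆ Module.End k (InducedSpace a N) :=
  ((Algebra.lsmul k k (InducedSpace a N) :
    UniversalEnvelopingAlgebra k a →ₐ[k] Module.End k (InducedSpace a N)) :
      UniversalEnvelopingAlgebra k a →ₗ⁅k⁆ Module.End k (InducedSpace a N)).comp
        (UniversalEnvelopingAlgebra.ι k)

theorem leftAction_tmul (y : a) (A : UniversalEnvelopingAlgebra k a) (v : N) :
    leftAction a N y (A ⊗ₜ v) = (UniversalEnvelopingAlgebra.ι k y * A) ⊗ₜ v := rfl

theorem inducedSpace_induction (Q : AddSubgroup (InducedSpace a N))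
    (h1 : ∀ v : N, (1 : UniversalEnvelopingAlgebra k a) ⊗ₜ[k] v ∈ Q)
    (ha : ∀ (y : a), ∀ w ∈ Q, leftAction a N y w ∈ Q) (w : InducedSpace a N) : w ∈ Q := by
  have key : ∀ (A B : UniversalEnvelopingAlgebra k a), (∀ v : N, B ⊗ₜ[k] v ∈ Q) →
      ∀ v : N, (A * B) ⊗ₜ[k] v ∈ Q := by
    intro A
    induction A using enveloping_induction with
    | hι y => exact fun B hB v => ha y _ (hB v)
    | halg c =>
      intro B hB v
      rw [← Algebra.smul_def, TensorProduct.smul_tmul]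
      exact hB _
    | hmul A A' hA hA' =>
      intro B hB v
      rw [mul_assoc]
      exact hA _ (hA' _ hB) v
    | hadd A A' hA hA' =>
      intro B hB v
      rw [add_mul, TensorProduct.add_tmul]
      exact add_mem (hA _ hB v) (hA' _ hB v)
  induction w using TensorProduct.induction_on with
  | zero => exact zero_mem _
  | add w w' hw hw' => exact add_mem hw hw'
  | tmul A v =>
    have := key A 1 h1 v
    rwa [mul_one] at this

/-- The map `v ↦ (1 ⊗ v, x ↦ 1 ⊗ x v)`, recording the prescribed action of `b` on `1 ⊗ N`. -/
def jetBase : N →ₗ[k] InducedSpace a N × (b →ₗ[k] InducedSpace a N) :=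
  LinearMap.prod (TensorProduct.mk k (UniversalEnvelopingAlgebra k a) N 1)
    (LinearMap.flip (LinearMap.compr₂ (π : b →ₗ[k] Module.End k N)
      (TensorProduct.mk k (UniversalEnvelopingAlgebra k a) N 1)))

/-- The `a`-linear extension of `jetBase` to `U(a) ⊗ N`. Its first component is the identity, and its
second component at `w` is `x ↦ x w`, which defines the action of `b` on `U(a) ⊗ N`. -/
def jet : InducedSpace a N →ₗ[k] InducedSpace a N × (b →ₗ[k] InducedSpace a N) :=
  TensorProduct.lift (LinearMap.lcomp k _ (jetBase π) ∘ₗ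
    (UniversalEnvelopingAlgebra.lift k (jetAction hab (leftAction a N))).toLinearMap)

theorem jet_one_tmul (v : N) : jet hab π (1 ⊗ₜ v) = jetBase π v := by
  rw [jet, TensorProduct.lift.tmul]
  change UniversalEnvelopingAlgebra.lift k (jetAction hab (leftAction a N)) 1 (jetBase π v) = _
  rw [map_one]
  rfl

theorem jet_leftAction (y : a) (w : InducedSpace a N) :
    jet hab π (leftAction a N y w) = jetAction hab (leftAction a N) y (jet hab π w) := by
  induction w using TensorProduct.induction_on with
  | zero => simp only [map_zero]
  | add w w' hw hw' => simp only [map_add, hw, hw']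
  | tmul A v =>
    rw [leftAction_tmul, jet, TensorProduct.lift.tmul, TensorProduct.lift.tmul]
    change UniversalEnvelopingAlgebra.lift k (jetAction hab (leftAction a N)) (_ * A) (jetBase π v)
      = jetAction hab (leftAction a N) y
        (UniversalEnvelopingAlgebra.lift k (jetAction hab (leftAction a N)) A (jetBase π v))
    rw [map_mul, UniversalEnvelopingAlgebra.lift_ι_apply]
    rfl

theorem jet_fst (w : InducedSpace a N) : (jet hab π w).1 = w := by
  refine inducedSpace_induction
    (((LinearMap.fst k _ _ ∘ₗ jet hab π) - LinearMap.id).toAddMonoidHom.ker) ?_ ?_ w |>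
      fun h => sub_eq_zero.1 h
  · intro v
    refine sub_eq_zero.2 ?_
    change (jet hab π (1 ⊗ₜ v)).1 = _
    rw [jet_one_tmul]
    rfl
  · intro y w hw
    refine sub_eq_zero.2 ?_
    have hw' : (jet hab π w).1 = w := sub_eq_zero.1 hw
    change (jet hab π (leftAction a N y w)).1 = leftAction a N y w
    rw [jet_leftAction]
    exact congrArg (leftAction a N y) hw'

/-- The action of `L = a ⊕ b` on `U(a) ⊗ N`, as a linear map: `a` acts by left multiplication and `b`
through `jet`. -/
def inducedLin : L →ₗ[k] Module.End k (InducedSpace a N) :=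
  (leftAction a N : a →ₗ[k] Module.End k (InducedSpace a N)) ∘ₗ fstProj hab +
    (LinearMap.flip (LinearMap.snd k _ _ ∘ₗ jet hab π)) ∘ₗ sndProj hab

theorem inducedLin_apply (x : L) (w : InducedSpace a N) : inducedLin hab π x w =
    leftAction a N (fstProj hab x) w + (jet hab π w).2 (sndProj hab x) := rfl

theorem inducedLin_fst (y : a) (w : InducedSpace a N) :
    inducedLin hab π (y : L) w = leftAction a N y w := by
  rw [inducedLin_apply, fstProj_fst, sndProj_fst, map_zero, add_zero]

theorem inducedLin_snd_one_tmul (x : b) (v : N) :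
    inducedLin hab π (x : L) (1 ⊗ₜ v) = 1 ⊗ₜ π x v := by
  rw [inducedLin_apply, fstProj_snd, sndProj_snd, map_zero, LinearMap.zero_apply, zero_add,
    jet_one_tmul]
  rfl

/-- The bracket relation between an element of `L` and an element of `a`; for elements of `b` it
is the `a`-linearity of `jet`. -/
theorem inducedLin_leftAction (x : L) (y : a) (w : InducedSpace a N) :
    inducedLin hab π x (leftAction a N y w) =
      leftAction a N y (inducedLin hab π x w) + inducedLin hab π ⁅x, (y : L)⁆ w := by
  -- both sides are linear in `x`, so `x` may be taken in `a` or in `b`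
  have h1 : ∀ z : a, inducedLin hab π (z : L) (leftAction a N y w) =
      leftAction a N y (inducedLin hab π z w) + inducedLin hab π ⁅(z : L), (y : L)⁆ w := by
    intro z
    rw [← LieSubalgebra.coe_bracket]
    simp only [inducedLin_fst, LieHom.map_lie, LieRing.of_associative_ring_bracket,
      LinearMap.sub_apply, Module.End.mul_apply]
    abel
  have h2 : ∀ z : b, inducedLin hab π (z : L) (leftAction a N y w) =
      leftAction a N y (inducedLin hab π z w) + inducedLin hab π ⁅(z : L), (y : L)⁆ w := by
    intro z
    simp only [inducedLin_apply, fstProj_snd, sndProj_snd, map_zero, LinearMap.zero_apply,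
      zero_add, jet_leftAction]
    have h3 : (jetAction hab (leftAction a N) y (jet hab π w)).2 z =
      leftAction a N y ((jet hab π w).2 z) +
        leftAction a N (fstProj hab ⁅(z : L), (y : L)⁆) (jet hab π w).1 +
        (jet hab π w).2 (sndProj hab ⁅(z : L), (y : L)⁆) := rfl
    rw [h3, jet_fst, add_assoc]
  rw [← fstProj_add_sndProj hab x]
  simp only [add_lie, map_add, LinearMap.add_apply, h1, h2]
  abel

theorem inducedLin_lie (x y : L) (w : InducedSpace a N) : inducedLin hab π ⁅x, y⁆ w =
    inducedLin hab π x (inducedLin hab π y w) - inducedLin hab π y (inducedLin hab π x w) := by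
  let Q : AddSubgroup (InducedSpace a N) :=
    { carrier := {w | ∀ x y : L, inducedLin hab π ⁅x, y⁆ w = inducedLin hab π x
        (inducedLin hab π y w) - inducedLin hab π y (inducedLin hab π x w)}
      zero_mem' := fun x y => by simp only [map_zero, sub_zero]
      add_mem' := fun hw hw' x y => by simp only [map_add, hw x y, hw' x y]; abel
      neg_mem' := fun hw x y => by simp only [map_neg, hw x y]; abel }
  refine inducedSpace_induction Q (fun v x y => ?_) (fun z w hw x y => ?_) w x y
  -- on `1 ⊗ v`, the relation for two elements of `b` is that of `π`, and the others hold everywhere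
  · have h1 : ∀ (x : L) (y : a) (w : InducedSpace a N), inducedLin hab π ⁅x, (y : L)⁆ w =
        inducedLin hab π x (inducedLin hab π y w) -
          inducedLin hab π y (inducedLin hab π x w) := by
      intro x y w
      rw [inducedLin_fst, inducedLin_fst, inducedLin_leftAction]
      abel
    have h2 : ∀ (x : a) (y : L) (w : InducedSpace a N), inducedLin hab π ⁅(x : L), y⁆ w =
        inducedLin hab π x (inducedLin hab π y w) -
          inducedLin hab π y (inducedLin hab π x w) := by
      intro x y w
      rw [← lie_skew, map_neg, LinearMap.neg_apply, h1]
      abel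
    have h3 : ∀ x y : b, inducedLin hab π ⁅(x : L), (y : L)⁆
        ((1 : UniversalEnvelopingAlgebra k a) ⊗ₜ v) =
        inducedLin hab π x (inducedLin hab π y (1 ⊗ₜ v)) -
          inducedLin hab π y (inducedLin hab π x (1 ⊗ₜ v)) := by
      intro x y
      rw [← LieSubalgebra.coe_bracket]
      simp only [inducedLin_snd_one_tmul, LieHom.map_lie, LieRing.of_associative_ring_bracket,
        LinearMap.sub_apply, Module.End.mul_apply, TensorProduct.tmul_sub]
    rw [← fstProj_add_sndProj hab x, ← fstProj_add_sndProj hab y]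
    simp only [add_lie, lie_add, map_add, LinearMap.add_apply, h1, h2, h3]
    abel
  -- the relation passes from `w` to `z w` by commuting `x` and `y` past `z`
  · have h4 : ⁅⁅x, y⁆, (z : L)⁆ = ⁅⁅x, (z : L)⁆, y⁆ + ⁅x, ⁅y, (z : L)⁆⁆ := by
      rw [lie_lie x y, ← lie_skew y ⁅x, (z : L)⁆]
      abel
    simp only [inducedLin_leftAction, map_add, h4, LinearMap.add_apply, hw _ _, map_sub]
    abel

/-- The representation of `L = a ⊕ b` on `U(a) ⊗ N` that extends the representation
`N = 1 ⊗ N` of `b`. -/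
def inducedRep : L →ₗ⁅k⁆ Module.End k (InducedSpace a N) :=
  { inducedLin hab π with
    map_lie' := fun {x y} => LinearMap.ext fun w => inducedLin_lie hab π x y w }

/-- The projection `U(a) ⊗ N → N` given by the augmentation of `U(a)`. -/
def inducedCounit (a : LieSubalgebra k L) (N : Type u) [AddCommGroup N] [Module k N] :
    InducedSpace a N →ₗ[k] N :=
  TensorProduct.lid k N ∘ₗ
    LinearMap.rTensor N (UniversalEnvelopingAlgebra.lift k (0 : a →ₗ⁅k⁆ k)).toLinearMap

theorem inducedCounit_tmul (A : UniversalEnvelopingAlgebra k a) (v : N) :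
    inducedCounit a N (A ⊗ₜ v) = UniversalEnvelopingAlgebra.lift k (0 : a →ₗ⁅k⁆ k) A • v := rfl

theorem inducedCounit_one_tmul (v : N) : inducedCounit a N (1 ⊗ₜ v) = v := by
  rw [inducedCounit_tmul, map_one, one_smul]

theorem inducedCounit_leftAction (y : a) (w : InducedSpace a N) :
    inducedCounit a N (leftAction a N y w) = 0 := by
  induction w using TensorProduct.induction_on with
  | zero => simp only [map_zero]
  | add w w' hw hw' => rw [map_add, map_add, hw, hw', add_zero]
  | tmul A v =>
    rw [leftAction_tmul, inducedCounit_tmul, map_mul, UniversalEnvelopingAlgebra.lift_ι_apply,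
      LieHom.zero_apply, zero_mul, zero_smul]

end Induced

section Main

attribute [local instance 100] LieRing.ofAssociativeRing

/-! ### The parabolic decomposition -/

variable {k : Type u} [Field k] [CharZero k] {h : Type u} [AddCommGroup h] [Module k h] {n : ℕ}
  (D : Datum k h n) (Ξ : Set (Fin n))

theorem isCompl_nilSpace_parabolicSpace (s : ℤˣ) :
    IsCompl (nilSpace D Ξ s) (parabolicSpace D Ξ (-s)) := by
  rw [nilSpace_eq, parabolicSpace_eq]
  constructor
  · refine disjoint_sumSpaces D (Set.disjoint_left.2 ?_)
    rintro _ ⟨⟨z, hz, rfl⟩, hα⟩ ⟨w, hw, hwz⟩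
    obtain rfl := wt_injective D hwz
    refine hα ?_
    rw [rootLattice_eq]
    refine ⟨w, fun i hi => ?_, rfl⟩
    have h1 := hz i hi
    have h2 := hw i hi
    rcases Int.units_eq_one_or s with rfl | rfl <;> simp at h1 h2 <;> omega
  · rw [codisjoint_iff, eq_top_iff, ← sumSpaces_univ D, ← sumSpaces_union]
    refine sumSpaces_le_of_roots D (fun _ => rootSpace_le_sumSpaces D (Or.inr
      (rootLattice_sub D Ξ (-s) (zero_mem_rootLattice D Ξ)))) fun α _ hα => ?_
    refine rootSpace_le_sumSpaces D ?_
    rcases signedRoots_of_roots D hα s with h1 | h1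
    · by_cases h2 : α ∈ rootLattice D Ξ
      · exact Or.inr (rootLattice_sub D Ξ (-s) h2)
      · exact Or.inl ⟨signedRoots_sub D Ξ s h1, h2⟩
    · exact Or.inr (signedRoots_sub D Ξ (-s) h1)

theorem inclP_ι (s : ℤˣ) (y : parabolic D Ξ s) :
    inclP D Ξ s (UniversalEnvelopingAlgebra.ι k y) = ιg D y := envMap_ι ..

theorem projP_ι (s : ℤˣ) (y : parabolic D Ξ s) :
    projP D Ξ s (UniversalEnvelopingAlgebra.ι k y) =
      UniversalEnvelopingAlgebra.ι k (leviProj D Ξ s y) := envMap_ι ..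

theorem inclP_algebraMap (s : ℤˣ) (c : k) : inclP D Ξ s (algebraMap k _ c) = algebraMap k _ c :=
  (envMap (parabolic D Ξ s).incl).commutes c

theorem projP_algebraMap (s : ℤˣ) (c : k) : projP D Ξ s (algebraMap k _ c) = algebraMap k _ c :=
  (envMap (leviProj D Ξ s)).commutes c

theorem inclL_algebraMap (c : k) : inclL D Ξ (algebraMap k _ c) = algebraMap k _ c :=
  (envMap (levi D Ξ).incl).commutes c

/-! ### Coinvariants of `Ind_!` -/

/-- A retraction of `x ↦ 1 ⊗ x` that kills `𝔲⁻_Ξ Ind_! N`. It factors through the representation of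
`𝔤` on `U(𝔲⁻_Ξ) ⊗ N` induced from `𝔭⁺_Ξ`. -/
theorem exists_retraction (N : Type u) [AddCommGroup N] [Module (Ul D Ξ) N] :
    ∃ ε : BalTensor (inclP D Ξ 1) (projP D Ξ 1) N →+ N,
      (∀ x, ε (tmk (inclP D Ξ 1) (projP D Ξ 1) 1 x) = x) ∧
        ∀ y ∈ nilradical D Ξ (-1), ∀ m, ε (ιg D y • m) = 0 := by
  -- `N` is only given as a `U𝔩_Ξ`-module, so its structure of `k`-vector space has to be restored
  let : Module k N := Module.compHom N (algebraMap k (Ul D Ξ))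
  have : IsScalarTower k (Ul D Ξ) N := IsScalarTower.of_algebraMap_smul fun _ _ => rfl
  have hab : IsCompl (nilradical D Ξ (-1)).toSubmodule (parabolic D Ξ 1).toSubmodule := by
    have := isCompl_nilSpace_parabolicSpace D Ξ (-1)
    rwa [neg_neg] at this
  let π : parabolic D Ξ 1 →ₗ⁅k⁆ Module.End k N :=
    ((Algebra.lsmul k k N : Ul D Ξ →ₐ[k] Module.End k N) : Ul D Ξ →ₗ⁅k⁆ Module.End k N).comp
      ((UniversalEnvelopingAlgebra.ι k).comp (leviProj D Ξ 1))
  let R : Ug D →ₐ[k] Module.End k (InducedSpace (nilradical D Ξ (-1)) N) :=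
    UniversalEnvelopingAlgebra.lift k (inducedRep hab π)
  have hR : ∀ x w, R (ιg D x) w = inducedLin hab π x w := fun x w =>
    LinearMap.congr_fun (UniversalEnvelopingAlgebra.lift_ι_apply (R := k) (inducedRep hab π) x) w
  let : Module (Ug D) (InducedSpace (nilradical D Ξ (-1)) N) := Module.compHom _ R.toRingHom
  let i : N →+ InducedSpace (nilradical D Ξ (-1)) N :=
    (TensorProduct.mk k (UniversalEnvelopingAlgebra k (nilradical D Ξ (-1))) N 1).toAddMonoidHom
  have hi : ∀ (Y : Up D Ξ 1) (x : N), i (projP D Ξ 1 Y • x) = inclP D Ξ 1 Y • i x := by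
    intro Y
    induction Y using enveloping_induction with
    | hι y =>
      intro x
      rw [projP_ι, inclP_ι]
      exact ((hR y (i x)).trans (inducedLin_snd_one_tmul hab π y x)).symm
    | halg c =>
      intro x
      rw [projP_algebraMap, inclP_algebraMap]
      refine ((TensorProduct.mk k _ N 1).map_smul c x).trans ?_
      have : R (algebraMap k _ c) = algebraMap k _ c := R.commutes c
      exact (congrArg (fun F => F (i x)) this).symm
    | hmul X Y hX hY => intro x; rw [map_mul, map_mul, mul_smul, mul_smul, hX, hY]
    | hadd X Y hX hY => intro x; rw [map_add, map_add, add_smul, add_smul, map_add, hX, hY]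
  let Φ := tlift (inclP D Ξ 1) (projP D Ξ 1) i hi
  refine ⟨(inducedCounit (nilradical D Ξ (-1)) N).toAddMonoidHom.comp Φ.toAddMonoidHom,
    fun x => ?_, fun y hy m => ?_⟩
  · change inducedCounit _ N (Φ (tmk (inclP D Ξ 1) (projP D Ξ 1) 1 x)) = x
    rw [tlift_tmk, one_smul]
    exact inducedCounit_one_tmul x
  · change inducedCounit _ N (Φ (ιg D y • m)) = 0
    rw [map_smul]
    have h1 : ιg D y • Φ m = leftAction (nilradical D Ξ (-1)) N ⟨y, hy⟩ (Φ m) :=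
      (hR y (Φ m)).trans (inducedLin_fst hab π ⟨y, hy⟩ (Φ m))
    rw [h1, inducedCounit_leftAction]

variable (N : ModuleCat.{u} (Ul D Ξ))

theorem coevStarApp_injective : Function.Injective (coevStarApp D Ξ N) := by
  obtain ⟨ε, h1, h2⟩ := exists_retraction D Ξ N
  let ε' : (indShriek D Ξ).obj N →+ N := ε
  have h3 : nilAct D Ξ ((indShriek D Ξ).obj N) ≤ ε'.ker := by
    rw [nilAct, AddSubgroup.closure_le]
    rintro _ ⟨y, hy, m, rfl⟩
    exact h2 y hy m
  refine (injective_iff_map_eq_zero _).2 fun x hx => ?_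
  rw [← h1 x]
  exact h3 ((coinvMk_eq_zero D Ξ _).1 hx)

theorem algebraMap_smul_nilAct (M : ModuleCat.{u} (Ug D)) (c : k) {m : M}
    (hm : m ∈ nilAct D Ξ M) : algebraMap k (Ug D) c • m ∈ nilAct D Ξ M := by
  have := nilAct_smul D Ξ M (algebraMap k _ c) m hm
  rwa [inclL_algebraMap] at this

theorem parabolic_smul_tmk (y : parabolic D Ξ 1) (x : N) :
    ιg D y • tmk (inclP D Ξ 1) (projP D Ξ 1) 1 x =
      tmk (inclP D Ξ 1) (projP D Ξ 1) 1 (UniversalEnvelopingAlgebra.ι k (leviProj D Ξ 1 y) • x) := by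
  rw [← projP_ι, ← tmk_balanced, inclP_ι, smul_tmk, mul_one, one_mul]

/-- The map `N → Ind_! N`, `x ↦ 1 ⊗ x`. -/
def tmkOne : N →+ (indShriek D Ξ).obj N :=
  AddMonoidHom.mk' (tmk (inclP D Ξ 1) (projP D Ξ 1) 1) (tmk_add _ _ 1)

/-- The decomposition `Ind_! N = 1 ⊗ N + 𝔲⁻_Ξ Ind_! N`. -/
theorem exists_sub_tmkOne_mem (m : (indShriek D Ξ).obj N) :
    ∃ x, m - tmkOne D Ξ N x ∈ nilAct D Ξ ((indShriek D Ξ).obj N) := by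
  let V := (tmkOne D Ξ N).range
  let U := nilAct D Ξ ((indShriek D Ξ).obj N)
  have hVk : ∀ (c : k), ∀ m ∈ V, algebraMap k (Ug D) c • m ∈ V := by
    rintro c _ ⟨x, rfl⟩
    refine ⟨algebraMap k (Ul D Ξ) c • x, ?_⟩
    rw [← projP_algebraMap D Ξ 1]
    refine (tmk_balanced (inclP D Ξ 1) (projP D Ξ 1) 1 (algebraMap k _ c) x).symm.trans ?_
    rw [inclP_algebraMap, one_mul]
    refine Eq.trans ?_ (smul_tmk (inclP D Ξ 1) (projP D Ξ 1) (algebraMap k (Ug D) c) 1 x).symm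
    rw [mul_one]
  have hmem : ∀ X : Ug D, ∀ m ∈ V, X • m ∈ V ⊔ U := by
    intro X m hm
    refine enveloping_smul_mem_of_sup_eq_top
      (isCompl_nilSpace_parabolicSpace D Ξ (-1)).sup_eq_top le_sup_left ?_ ?_ ?_ X hm
    · intro c m hm
      obtain ⟨v, hv, w, hw, rfl⟩ := AddSubgroup.mem_sup.1 hm
      rw [smul_add]
      exact add_mem (AddSubgroup.mem_sup_left (hVk c v hv))
        (AddSubgroup.mem_sup_right (algebraMap_smul_nilAct D Ξ _ c hw))
    · rintro y hy _ ⟨x, rfl⟩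
      rw [neg_neg] at hy
      exact ⟨_, (parabolic_smul_tmk D Ξ N ⟨y, hy⟩ x).symm⟩
    · exact fun y hy m _ => AddSubgroup.mem_sup_right (AddSubgroup.subset_closure ⟨y, hy, m, rfl⟩)
  have htop : V ⊔ U = ⊤ := by
    rw [eq_top_iff]
    intro m _
    obtain ⟨m, rfl⟩ := Submodule.mkQ_surjective _ m
    induction m using TensorProduct.induction_on with
    | zero => rw [map_zero]; exact zero_mem _
    | add m m' hm hm' => rw [map_add]; exact add_mem (hm trivial) (hm' trivial)
    | tmul X x =>
      have h1 := hmem X _ ⟨x, rfl⟩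
      have h2 : X • tmkOne D Ξ N x = tmk (inclP D Ξ 1) (projP D Ξ 1) X x :=
        (smul_tmk (inclP D Ξ 1) (projP D Ξ 1) X 1 x).trans (by rw [mul_one])
      rwa [h2] at h1
  obtain ⟨_, ⟨x, rfl⟩, w, hw, rfl⟩ := AddSubgroup.mem_sup.1 (htop ▸ AddSubgroup.mem_top m)
  exact ⟨x, by rwa [add_sub_cancel_left]⟩

theorem coevStarApp_bijective : Function.Bijective (coevStarApp D Ξ N) := by
  refine ⟨coevStarApp_injective D Ξ N, fun m => ?_⟩
  obtain ⟨m, rfl⟩ := Submodule.mkQ_surjective _ m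
  obtain ⟨x, hx⟩ := exists_sub_tmkOne_mem D Ξ N m
  refine ⟨x, ?_⟩
  have := (coinvMk_eq_zero D Ξ ((indShriek D Ξ).obj N)).2 hx
  exact (sub_eq_zero.1 ((map_sub (coinvMk D Ξ ((indShriek D Ξ).obj N)) m _).symm.trans this)).symm

theorem isIso_of_bijective {C R : Type*} [Category* C] [Ring R] {F G : C ⥤ ModuleCat.{u} R}
    (η : F ⟶ G) (hη : ∀ X, Function.Bijective (η.app X).hom) : IsIso η := by
  have : ∀ X, IsIso (η.app X) := fun X => (ConcreteCategory.isIso_iff_bijective _).2 (hη X)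
  exact NatIso.isIso_of_isIso_app η

theorem isIso_coevStar : IsIso (coevStar D Ξ) :=
  isIso_of_bijective _ (coevStarApp_bijective D Ξ)

/-! ### Invariants of `Ind_*` -/

/-- The injectivity of `ev^!`: the invariant `φ` generates a `U𝔤`-submodule on which evaluation at
`1` vanishes, while `φ(X) = (τ(X) φ)(1)`. -/
theorem eq_zero_of_mem_invariants (φ : (indStar D Ξ).obj N)
    (hφ : φ ∈ invariants D Ξ ((indStar D Ξ).obj N)) (h1 : evalOne D Ξ N φ = 0) : φ = 0 := by
  let S := (evalOne D Ξ N).ker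
  let V : AddSubgroup ((indStar D Ξ).obj N) :=
    (invariants D Ξ ((indStar D Ξ).obj N)).toAddSubgroup ⊓ S
  have hS : ∀ (Y : Up D Ξ (-1)), ∀ ψ ∈ S, inclP D Ξ (-1) Y • ψ ∈ S := by
    intro Y ψ hψ
    refine (evalOne_smul D Ξ N Y ψ).trans ?_
    rw [show evalOne D Ξ N ψ = 0 from hψ, smul_zero]
  have hmem : ∀ X : Ug D, X • φ ∈ S := by
    intro X
    refine enveloping_smul_mem_of_sup_eq_top (V := V)
      (sup_comm _ _ |>.trans (isCompl_nilSpace_parabolicSpace D Ξ 1).sup_eq_top)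
      inf_le_right ?_ ?_ ?_ X ⟨hφ, h1⟩
    · intro c ψ hψ
      rw [← inclP_algebraMap D Ξ (-1)]
      exact hS _ ψ hψ
    · intro y hy ψ hψ
      have : ιg D y • ψ = 0 := hψ.1 y hy
      rw [this]
      exact zero_mem _
    · intro y hy ψ hψ
      have := hS (UniversalEnvelopingAlgebra.ι k ⟨y, hy⟩) ψ hψ
      rwa [inclP_ι] at this
  refine coind_ext D Ξ fun X => ?_
  have h2 : (φ : coind D Ξ N).1 (tau D (tau D X) * 1) = 0 := hmem (tau D X)
  rw [tau_tau, mul_one] at h2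
  exact h2

theorem tmkOne_mem_invariants (x : N) :
    tmkOne D Ξ N x ∈ invariants D Ξ ((indShriek D Ξ).obj N) := by
  intro y hy
  refine (parabolic_smul_tmk D Ξ N ⟨y, nil_le_parabolic D Ξ 1 hy⟩ x).trans ?_
  rw [leviProj_nil D Ξ 1 y hy, map_zero, zero_smul]
  exact (tmkOne D Ξ N).map_zero

/-- The invariant element `φ_x = (X ↦ coev⁻¹ [τ(X) (1 ⊗ x)])` of `Ind_* N`, with value `x`
at `1`. -/
theorem exists_mem_invariants (x : N) : ∃ φ : (indStar D Ξ).obj N,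
    φ ∈ invariants D Ξ ((indStar D Ξ).obj N) ∧ evalOne D Ξ N φ = x ∧
    ((indStar D Ξ).map ((coevStar D Ξ).app N)).hom φ =
      unitStarApp D Ξ ((indShriek D Ξ).obj N) (tmkOne D Ξ N x) := by
  let E := LinearEquiv.ofBijective _ (coevStarApp_bijective D Ξ N)
  let ψ := unitStarApp D Ξ ((indShriek D Ξ).obj N) (tmkOne D Ξ N x)
  let φ : (indStar D Ξ).obj N := coindMap D Ξ E.symm.toLinearMap ψ
  refine ⟨φ, fun y hy => ?_, ?_, ?_⟩
  · refine (map_smul (coindMap D Ξ E.symm.toLinearMap) (ιg D y) ψ).symm.trans ?_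
    rw [← map_smul (unitStarApp D Ξ ((indShriek D Ξ).obj N)), tmkOne_mem_invariants D Ξ N x y hy,
      map_zero, map_zero]
    rfl
  · change E.symm (coinvMk D Ξ ((indShriek D Ξ).obj N) (tau D 1 • tmkOne D Ξ N x)) = x
    rw [tau_one, one_smul]
    exact E.symm_apply_apply x
  · exact coind_ext D Ξ fun X => E.apply_symm_apply _

theorem isIso_evShriek : IsIso (evShriek D Ξ) := by
  refine isIso_of_bijective _ fun N =>
    ⟨(injective_iff_map_eq_zero ((evShriek D Ξ).app N).hom).2 fun φ hφ => ?_, fun x => ?_⟩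
  · exact Subtype.ext (eq_zero_of_mem_invariants D Ξ N φ.1 φ.2 hφ)
  · obtain ⟨φ, h1, h2, -⟩ := exists_mem_invariants D Ξ N x
    exact ⟨⟨φ, h1⟩, h2⟩

/-! ### The comparison map and its image -/

variable [IsIso (evShriek D Ξ)]

/-- The comparison map sends `1 ⊗ x` to the invariant element with value `x` at `1`. -/
theorem comparison_tmkOne (x : N) (φ : (indStar D Ξ).obj N)
    (hφ : φ ∈ invariants D Ξ ((indStar D Ξ).obj N)) (h1 : evalOne D Ξ N φ = x) :
    ((comparison D Ξ).app N).hom (tmkOne D Ξ N x) = φ := by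
  have h2 : ((inv (evShriek D Ξ)).app N).hom x = ⟨φ, hφ⟩ := by
    have h3 : ((evShriek D Ξ).app N).hom ⟨φ, hφ⟩ = x := h1
    rw [← h3]
    have h4 := congrArg (fun f => f.app N) (IsIso.hom_inv_id (evShriek D Ξ))
    exact congrArg (fun f => f.hom ⟨φ, hφ⟩) h4
  change counitShriekApp D Ξ ((indStar D Ξ).obj N)
    (tmap (inclP D Ξ 1) (projP D Ξ 1) ((inv (evShriek D Ξ)).app N).hom
      (tmk (inclP D Ξ 1) (projP D Ξ 1) 1 x)) = φ
  rw [tmap_tmk, h2]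
  exact (counitShriekApp_tmk D Ξ ((indStar D Ξ).obj N) 1 ⟨φ, hφ⟩).trans (one_smul _ φ)

theorem comparison_comp_coevStar : (comparison D Ξ).app N ≫ (indStar D Ξ).map ((coevStar D Ξ).app N)
    = (unitStar D Ξ).app ((indShriek D Ξ).obj N) := by
  refine ModuleCat.hom_ext (BalTensor.hom_ext (inclP D Ξ 1) (projP D Ξ 1) fun x => ?_)
  obtain ⟨φ, h1, h2, h3⟩ := exists_mem_invariants D Ξ N x
  refine Eq.trans ?_ h3
  exact congrArg ((indStar D Ξ).map ((coevStar D Ξ).app N)).hom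
    (comparison_tmkOne D Ξ N x φ h1 h2)

/-- Surjectivity of evaluation at `1` on the invariants of `Ind_!* N`. -/
theorem exists_indMid (x : N) : ∃ φ : (indMid D Ξ).obj N,
    φ ∈ invariants D Ξ ((indMid D Ξ).obj N) ∧ evalOne D Ξ N φ.1 = x := by
  obtain ⟨φ, h1, h2, -⟩ := exists_mem_invariants D Ξ N x
  exact ⟨⟨φ, tmkOne D Ξ N x, comparison_tmkOne D Ξ N x φ h1 h2⟩,
    fun y hy => Subtype.ext (h1 y hy), h2⟩

/-- Injectivity of evaluation at `1` on the coinvariants of `Ind_!* N`. -/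
theorem mem_nilAct_indMid (φ : (indMid D Ξ).obj N) (hφ : evalOne D Ξ N φ.1 = 0) :
    φ ∈ nilAct D Ξ ((indMid D Ξ).obj N) := by
  obtain ⟨_, m, rfl⟩ := φ
  obtain ⟨x, hx⟩ := exists_sub_tmkOne_mem D Ξ N m
  let F : (indShriek D Ξ).obj N →ₗ[Ug D] (indMid D Ξ).obj N :=
    ((comparison D Ξ).app N).hom.rangeRestrict
  have hF : ∀ u ∈ nilAct D Ξ ((indShriek D Ξ).obj N), F u ∈ nilAct D Ξ ((indMid D Ξ).obj N) :=
    fun u hu => nilImage_le_comap D Ξ (ModuleCat.ofHom F) hu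
  have h1 : evalOne D Ξ N (F (m - tmkOne D Ξ N x)).1 = 0 :=
    evalOne_nilAct D Ξ N _ (nilImage_le_comap D Ξ ((comparison D Ξ).app N) hx)
  obtain ⟨φ, h2, h3, -⟩ := exists_mem_invariants D Ξ N x
  have h4 : x = 0 := by
    rw [map_sub] at h1
    have h5 := (map_sub (evalOne D Ξ N) (F m).1 (F (tmkOne D Ξ N x)).1).symm.trans h1
    have h6 : (F (tmkOne D Ξ N x)).1 = φ := comparison_tmkOne D Ξ N x φ h2 h3
    rw [h6, h3, show evalOne D Ξ N (F m).1 = 0 from hφ, zero_sub, neg_eq_zero] at h5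
    exact h5
  rw [h4, map_zero, sub_zero] at hx
  exact hF m hx

end Main

end KacMoody

end

theorem mainTheorem2 {k : Type u} [Field k] [IsAlgClosed k] [CharZero k] {h : Type u}
    [AddCommGroup h] [Module k h] {n : ℕ} (D : KacMoody.Datum k h n) (Ξ : Set (Fin n)) :
    ∃ (_ : IsIso (KacMoody.evShriek D Ξ)) (_ : IsIso (KacMoody.coevStar D Ξ)),
      (∀ N, (KacMoody.comparison D Ξ).app N ≫
          (KacMoody.indStar D Ξ).map ((KacMoody.coevStar D Ξ).app N) =
        (KacMoody.unitStar D Ξ).app ((KacMoody.indShriek D Ξ).obj N)) ∧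
      (∃ φ : KacMoody.indMid D Ξ ⋙ KacMoody.resShriek D Ξ ≅ 𝟭 (ModuleCat.{u} (KacMoody.Ul D Ξ)),
        φ.hom = Functor.whiskerRight (KacMoody.imageι (KacMoody.comparison D Ξ))
          (KacMoody.resShriek D Ξ) ≫ KacMoody.evShriek D Ξ) ∧
      (∃ φ : KacMoody.indMid D Ξ ⋙ KacMoody.resStar D Ξ ≅ 𝟭 (ModuleCat.{u} (KacMoody.Ul D Ξ)),
        φ.hom = Functor.whiskerRight (KacMoody.imageι (KacMoody.comparison D Ξ))
          (KacMoody.resStar D Ξ) ≫ KacMoody.evStar D Ξ) ∧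
      (∃ φ : KacMoody.indMid D Ξ ⋙ KacMoody.resMid D Ξ ≅ 𝟭 (ModuleCat.{u} (KacMoody.Ul D Ξ)),
        φ.hom = Functor.whiskerLeft (KacMoody.indMid D Ξ)
            (KacMoody.imageι (KacMoody.resMap D Ξ)) ≫
          Functor.whiskerRight (KacMoody.imageι (KacMoody.comparison D Ξ))
            (KacMoody.resStar D Ξ) ≫ KacMoody.evStar D Ξ) := by
  have hev := KacMoody.isIso_evShriek D Ξ
  have hiso : ∀ {F : ModuleCat.{u} (KacMoody.Ul D Ξ) ⥤ ModuleCat.{u} (KacMoody.Ul D Ξ)}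
      (η : F ⟶ 𝟭 _), (∀ N, Function.Bijective (η.app N).hom) → ∃ φ : F ≅ 𝟭 _, φ.hom = η := by
    intro F η hη
    have := KacMoody.isIso_of_bijective η hη
    exact ⟨asIso η, rfl⟩
  -- evaluation at `1` is injective on coinvariants, hence on the image of `Res^!` in them
  have hstar : ∀ N, Function.Injective ((Functor.whiskerRight
      (KacMoody.imageι (KacMoody.comparison D Ξ)) (KacMoody.resStar D Ξ) ≫
        KacMoody.evStar D Ξ).app N).hom := by
    refine fun N => (injective_iff_map_eq_zero _).2 fun φ hφ => ?_
    obtain ⟨φ, rfl⟩ := Submodule.mkQ_surjective _ φ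
    exact (KacMoody.coinvMk_eq_zero D Ξ _).2 (KacMoody.mem_nilAct_indMid D Ξ N φ hφ)
  refine ⟨hev, KacMoody.isIso_coevStar D Ξ, fun N => KacMoody.comparison_comp_coevStar D Ξ N,
    hiso _ fun N => ⟨?_, fun x => ?_⟩, hiso _ fun N => ⟨hstar N, fun x => ?_⟩,
    hiso _ fun N => ⟨?_, fun x => ?_⟩⟩
  · refine (injective_iff_map_eq_zero _).2 fun φ hφ => Subtype.ext (Subtype.ext ?_)
    exact KacMoody.eq_zero_of_mem_invariants D Ξ N φ.1.1
      (fun y hy => congrArg Subtype.val (φ.2 y hy)) hφ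
  · obtain ⟨φ, h1, h2⟩ := KacMoody.exists_indMid D Ξ N x
    exact ⟨⟨φ, h1⟩, h2⟩
  · obtain ⟨φ, -, h2⟩ := KacMoody.exists_indMid D Ξ N x
    exact ⟨KacMoody.coinvMk D Ξ ((KacMoody.indMid D Ξ).obj N) φ, h2⟩
  · exact (hstar N).comp Subtype.val_injective
  · obtain ⟨φ, h1, h2⟩ := KacMoody.exists_indMid D Ξ N x
    exact ⟨⟨KacMoody.coinvMk D Ξ ((KacMoody.indMid D Ξ).obj N) φ, ⟨φ, h1⟩, rfl⟩, h2⟩
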